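/- Let $c_0\in(0,1]$. For $\sigma^2\in(0,\tfrac12]$ let $\mathcal P(\sigma^2)=\mathcal P(c_0,\sigma^2)$ be the set of all symmetric probability distributions $p$ on $\mathbb Z$ with variance $\sigma^2$ such that $p(1)\ge \tfrac12 c_0\sigma^2$ and $\sum_{k\in\mathbb Z}|k|^3p(k)\le c_0^{-1}\sigma^2$. For integers $L,j\ge 0$ let $\Omega_{0,L}$ be the set of $\gamma=(\gamma_0,\dots,\gamma_L)\in\mathbb Z^{L+1}$ with $\gamma_0=\gamma_L=0$, let $\Omega^{+,j}_{0,L}$ be the set of $\gamma\in\Omega_{0,L}$ with $\gamma_i\ge -j$ for all $i$, and put $$w(\gamma)=\prod_{i=1}^L p(\gamma_i-\gamma_{i-1}),\qquad Z_{0,L}=\sum_{\gamma\in\Omega_{0,L}}w(\gamma),\qquad Z^{+,j}_{0,L}=\sum_{\gamma\in\Omega^{+,j}_{0,L}}w(\gamma).$$ Let $N(\gamma)=\#\{1\le i\le L-1:\gamma_i=0\}$, and let $\mathbb E^{+,j}_{0,L}$ be the expectation with respect to the probability $w(\gamma)/Z^{+,j}_{0,L}$ on $\Omega^{+,j}_{0,L}$.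 Theorem. For every $c_0\in(0,1]$ there exist constants $a\ge b>0$ and $c>0$, depending only on $c_0$, such that for every integer $j\ge 0$, every $\sigma^2\in(0,\tfrac12]$ and every $p\in\mathcal P(c_0,\sigma^2)$ the following holds for every real $\varepsilon$. (i) If $\varepsilon\ge a\sigma^2/(j+1)$, then for all $L$ large enough $$\mathbb E^{+,j}_{0,L}\big[e^{\varepsilon N}\big]\ge \exp\big(c\,\sigma^2L\,(j+1)^{-2}\big).$$ (ii) If $\varepsilon\le b\sigma^2/(j+1)$, then for all $L\ge 0$ $$\mathbb E^{+,j}_{0,L}\big[e^{\varepsilon N}\big]\le 2\,\frac{Z_{0,L}}{Z^{+,j}_{0,L}}.$$ -/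

import Mathlib

open Filter

/-- The class of symmetric probabilities on the integers with variance `σ2` (the mean vanishes
by symmetry), `p 1 ≥ c₀ σ2 / 2` and third absolute moment finite and at most `σ2 / c₀`. -/
structure WalkClass (c₀ σ2 : ℝ) (p : ℤ → ℝ) : Prop where
  nonneg : ∀ k, 0 ≤ p k
  total : HasSum p 1
  symm : ∀ k, p (-k) = p k
  variance : HasSum (fun k : ℤ => (k : ℝ) ^ 2 * p k) σ2
  one_step : c₀ * σ2 / 2 ≤ p 1
  third_summable : Summable fun k : ℤ => |(k : ℝ)| ^ 3 * p k
  third_le : ∑' k : ℤ, |(k : ℝ)| ^ 3 * p k ≤ c₀⁻¹ * σ2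

/-- Integer trajectories of `L` steps that start and end at zero. -/
def bridges (L : ℕ) : Set (Fin (L + 1) → ℤ) :=
  {γ | γ 0 = 0 ∧ γ (Fin.last L) = 0}

/-- Bridges that stay at or above height `-j`. -/
def bridgesAbove (j L : ℕ) : Set (Fin (L + 1) → ℤ) :=
  {γ | γ ∈ bridges L ∧ ∀ i, -(j : ℤ) ≤ γ i}

/-- The weight of a trajectory: the product of `p` over its increments. -/
noncomputable def pathWeight (p : ℤ → ℝ) {L : ℕ} (γ : Fin (L + 1) → ℤ) : ℝ :=
  ∏ i : Fin L, p (γ i.succ - γ i.castSucc)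

/-- The number of zeros of the trajectory at the times `1, …, L - 1`. -/
def contacts {L : ℕ} (γ : Fin (L + 1) → ℤ) : ℕ :=
  (Finset.univ.filter fun i : Fin (L + 1) => 0 < (i : ℕ) ∧ (i : ℕ) < L ∧ γ i = 0).card

/-- The partition function of all bridges. -/
noncomputable def partitionFn (p : ℤ → ℝ) (L : ℕ) : ℝ :=
  ∑' γ : bridges L, pathWeight p γ.1

/-- The partition function of the bridges above the wall at `-j`. -/
noncomputable def partitionFnAbove (p : ℤ → ℝ) (j L : ℕ) : ℝ :=
  ∑' γ : bridgesAbove j L, pathWeight p γ.1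

/-- The law of the bridge conditioned to stay above the wall at `-j`. -/
noncomputable def lawAbove (p : ℤ → ℝ) (j L : ℕ) (γ : bridgesAbove j L) : ℝ :=
  pathWeight p γ.1 / partitionFnAbove p j L

/-- The expectation of `f` under `lawAbove`. -/
noncomputable def expectAbove (p : ℤ → ℝ) (j L : ℕ) (f : (Fin (L + 1) → ℤ) → ℝ) : ℝ :=
  ∑' γ : bridgesAbove j L, f γ.1 * lawAbove p j L γ

theorem summable_steps {p : ℤ → ℝ} (h0 : ∀ k, 0 ≤ p k) (hs : Summable p) (n : ℕ) :
    Summable fun x : Fin n → ℤ => ∏ i, p (x i) := by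
  induction n with
  | zero => exact (hasSum_fintype _).summable
  | succ n ih =>
    have h := Summable.mul_of_nonneg hs ih h0 (fun x => Finset.prod_nonneg fun i _ => h0 _)
    rw [← (Fin.consEquiv fun _ => ℤ).summable_iff]
    refine h.congr fun x => ?_
    simp [Fin.prod_univ_succ, Fin.consEquiv]

/-- The weights of bridges are summable, so the sums in the partition functions converge. -/
theorem summable_pathWeight {p : ℤ → ℝ} (h0 : ∀ k, 0 ≤ p k) (hs : Summable p) (L : ℕ) :
    Summable fun γ : bridges L => pathWeight p γ.1 := by
  have h := summable_steps h0 hs L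
  refine h.comp_injective (i := fun γ : bridges L => fun i : Fin L => γ.1 i.succ - γ.1 i.castSucc) ?_
  intro γ γ' hh
  ext i
  induction i using Fin.induction with
  | zero => rw [γ.2.1, γ'.2.1]
  | succ i ih =>
    have := congrFun hh i
    simp only at this
    omega

/-!
The proof compares the walk pinned at the origin and killed below `-j` with the free walk through
the Dirichlet form `‖u‖² - ⟪u, P u⟫` on `ℓ²(ℤ)`, where `P` is convolution with `p`. This form lies
between `p 1` and `σ² / 2` times the nearest-neighbour form `‖∇u‖²`
(`IsSymmStep.energy_lower`, `IsSymmStep.energy_upper`), so that no fine potential theory of the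
walk, and no third moment, is needed. Partition functions are entries at the origin of iterated
operators (`hasSum_paths`, `IsSymmStep.hasSum_pinned`).

Large reward. The symmetrized transfer operator `T` of the pinned walk has, at a tent of width
`j + 1` centred at the origin, a Rayleigh quotient at least `exp (σ² / (12 (j + 1)²))`: the energy
of the tent is at most `σ² (j + 1)`, and the reward gained at its apex exceeds this when
`ε ≥ 4 σ² / (j + 1)` (`IsSymmStep.rayleigh_tent`). Log-convexity of `n ↦ ‖T ^ n φ‖` turns the
Rayleigh quotient into exponential growth of the partition function, up to a constant factor that
half of the exponent absorbs (`IsSymmStep.exists_pinnedProfile_lower`).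

Small reward. Let `z n` and `a n` be the return weights of the free walk and of the killed walk
without reward. Two facts suffice. The Green function `∑ a n` is at most `(j + 1) / p 1`: a Green
function has energy at most its value at the origin, and it vanishes at `-j - 1`, so its value at
the origin is controlled by its gradient (`IsSymmStep.sum_pinnedProfile_zero_le`). The sequence
`z` is doubling with a constant that depends on `c₀` only (`WalkClass.freeProfile_doubling`); the
upper bound on `z n` of order `1 / (1 + σ √n)` comes from the same energy estimate for the Green
function up to time `n`, the matching lower bound from Chebyshev and Cauchy-Schwarz. The pinned
partition function solves a renewal equation with kernel `(exp ε - 1) a`, whose mass is small when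
`ε ≤ b σ² / (j + 1)`, and doubling then gives the bound `2 z` by induction
(`renewal_le_two_mul`).
-/

/-! ### The Hilbert space of square-summable sequences -/

/-- The Hilbert space of square-summable real sequences indexed by `ℤ`. -/
abbrev SeqL2 : Type := lp (fun _ : ℤ => ℝ) 2

theorem memℓp_two_iff {f : ℤ → ℝ} : Memℓp f 2 ↔ Summable fun x => f x ^ 2 := by
  rw [memℓp_gen_iff (by norm_num)]
  simp

theorem memℓp_two_of_support {f : ℤ → ℝ} (s : Finset ℤ) (hf : ∀ x ∉ s, f x = 0) :
    Memℓp f 2 :=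
  memℓp_two_iff.2 (summable_of_ne_finset_zero (s := s) fun x hx => by simp [hf x hx])

namespace SeqL2

theorem hasSum_mul (u v : SeqL2) : HasSum (fun x => u x * v x) (inner ℝ u v) := by
  have h := lp.hasSum_inner (𝕜 := ℝ) u v
  exact h.congr_fun fun x => by simp [mul_comm]

theorem hasSum_sq (u : SeqL2) : HasSum (fun x => u x ^ 2) (‖u‖ ^ 2) := by
  have h := hasSum_mul u u
  rw [real_inner_self_eq_norm_sq] at h
  simpa [sq] using h

theorem sum_sq_le (u : SeqL2) (s : Finset ℤ) : ∑ x ∈ s, u x ^ 2 ≤ ‖u‖ ^ 2 :=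
  sum_le_hasSum s (fun _ _ => sq_nonneg _) (hasSum_sq u)

theorem inner_eq_sum {s : Finset ℤ} {u : SeqL2} (hu : ∀ x ∉ s, u x = 0) (v : SeqL2) :
    inner ℝ u v = ∑ x ∈ s, u x * v x :=
  (hasSum_mul u v).unique (hasSum_sum_of_ne_finset_zero fun x hx => by simp [hu x hx])

/-- The unit mass at the origin. -/
noncomputable def delta : SeqL2 := lp.single 2 0 1

theorem delta_apply (x : ℤ) : delta x = if x = 0 then 1 else 0 := by
  simp [delta, lp.single_apply, Pi.single_apply]

theorem delta_nonneg (x : ℤ) : 0 ≤ delta x := by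
  rw [delta_apply]; split_ifs <;> simp

theorem inner_nonneg {u v : SeqL2} (hu : ∀ x, 0 ≤ u x) (hv : ∀ x, 0 ≤ v x) :
    0 ≤ inner ℝ u v := (hasSum_mul u v).nonneg fun x => mul_nonneg (hu x) (hv x)

theorem inner_delta_left (u : SeqL2) : inner ℝ delta u = u 0 := by
  rw [delta, lp.inner_single_left]; simp

theorem inner_delta_right (u : SeqL2) : inner ℝ u delta = u 0 := by
  rw [real_inner_comm, inner_delta_left]

/-- Translation by `k`. -/
noncomputable def shift (k : ℤ) : SeqL2 →ₗᵢ[ℝ] SeqL2 where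
  toFun u := ⟨fun x => u (x - k), memℓp_two_iff.2
    ((Equiv.subRight k).summable_iff (f := fun x => u x ^ 2) |>.2 (hasSum_sq u).summable)⟩
  map_add' u v := rfl
  map_smul' c u := rfl
  norm_map' u := by
    refine (sq_eq_sq₀ (norm_nonneg _) (norm_nonneg _)).1 ?_
    exact (hasSum_sq _).unique (((Equiv.subRight k).hasSum_iff (f := fun x => u x ^ 2)).2
      (hasSum_sq u))

@[simp] theorem shift_apply (k : ℤ) (u : SeqL2) (x : ℤ) : shift k u x = u (x - k) := rfl

theorem shift_add (k l : ℤ) (u : SeqL2) : shift (k + l) u = shift k (shift l u) := by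
  ext x; simp [sub_sub]

theorem inner_shift_left (k : ℤ) (u v : SeqL2) :
    inner ℝ (shift k u) v = inner ℝ u (shift (-k) v) := by
  rw [← (shift (-k)).inner_map_map, ← shift_add]
  congr 1
  ext x; simp

/-- Pointwise multiplication by a function bounded by `C`. -/
noncomputable def mulOp (V : ℤ → ℝ) (C : ℝ) (hV : ∀ x, |V x| ≤ C) : SeqL2 →L[ℝ] SeqL2 :=
  LinearMap.mkContinuous
    { toFun := fun u => ⟨fun x => V x * u x, by
        refine (((lp.memℓp u).norm).const_mul C).mono fun x => ?_
        rw [norm_mul]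
        exact mul_le_mul_of_nonneg_right (hV x) (norm_nonneg _)⟩
      map_add' := fun u v => by ext x; exact mul_add _ _ _
      map_smul' := fun c u => by ext x; simp [mul_left_comm] } C fun u => by
    have hC : 0 ≤ C := (abs_nonneg _).trans (hV 0)
    refine le_of_sq_le_sq ?_ (by positivity)
    rw [mul_pow]
    refine hasSum_le (fun x => ?_) (hasSum_sq _) ((hasSum_sq u).mul_left (C ^ 2))
    change (V x * u x) ^ 2 ≤ _
    rw [mul_pow]
    exact mul_le_mul_of_nonneg_right (sq_le_sq' (neg_le_of_abs_le (hV x))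
      (le_of_abs_le (hV x))) (sq_nonneg _)

@[simp] theorem mulOp_apply {V : ℤ → ℝ} {C : ℝ} (hV : ∀ x, |V x| ≤ C) (u : SeqL2) (x : ℤ) :
    mulOp V C hV u x = V x * u x := rfl

theorem inner_mulOp {V : ℤ → ℝ} {C : ℝ} (hV : ∀ x, |V x| ≤ C) (u v : SeqL2) :
    inner ℝ (mulOp V C hV u) v = inner ℝ u (mulOp V C hV v) :=
  (hasSum_mul _ v).unique (by
    simpa [mul_assoc, mul_comm, mul_left_comm] using hasSum_mul u (mulOp V C hV v))

theorem norm_shift_sub_le (u : SeqL2) (k : ℤ) :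
    ‖shift k u - u‖ ≤ |(k : ℝ)| * ‖shift 1 u - u‖ := by
  have hnat : ∀ n : ℕ, ‖shift n u - u‖ ≤ n * ‖shift 1 u - u‖ := by
    intro n
    induction n with
    | zero =>
      have : shift 0 u = u := by ext x; simp
      simp [this]
    | succ n ih =>
      have h : shift ((n + 1 : ℕ) : ℤ) u - u = shift n (shift 1 u - u) + (shift n u - u) := by
        rw [map_sub, ← shift_add]; push_cast; abel
      rw [h]
      refine (norm_add_le _ _).trans ?_
      rw [LinearIsometry.norm_map]
      push_cast
      linarith
  obtain ⟨n, rfl | rfl⟩ := k.eq_nat_or_neg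
  · simpa using hnat n
  · have h : shift (-(n : ℤ)) u - u = - shift (-(n : ℤ)) (shift n u - u) := by
      rw [map_sub, ← shift_add]
      have : shift (-(n : ℤ) + n) u = u := by ext x; simp
      rw [this]; abel
    rw [h, norm_neg, LinearIsometry.norm_map]
    simpa using hnat n

/-- Cauchy-Schwarz along the increments of `u` between `x` and `x + n`. -/
theorem sub_sq_le (u : SeqL2) (x : ℤ) (n : ℕ) :
    (u (x + n) - u x) ^ 2 ≤ n * ‖shift 1 u - u‖ ^ 2 := by
  have htel : u (x + n) - u x = ∑ i ∈ Finset.range n, -((shift 1 u - u) (x + i + 1)) := by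
    induction n with
    | zero => simp
    | succ n ih =>
      rw [Finset.sum_range_succ, ← ih]
      simp only [lp.coeFn_sub, Pi.sub_apply, shift_apply]
      push_cast
      rw [add_sub_cancel_right, ← add_assoc]
      ring
  rw [htel]
  refine sq_sum_le_card_mul_sum_sq.trans ?_
  rw [Finset.card_range]
  refine mul_le_mul_of_nonneg_left ?_ (by positivity)
  simp only [neg_sq]
  have hinj : Set.InjOn (fun i : ℕ => x + i + 1) (Finset.range n : Set ℕ) := by
    intro a _ b _ hab; simpa using hab
  rw [← Finset.sum_image (f := fun y => (shift 1 u - u) y ^ 2) hinj]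
  exact sum_sq_le _ _

end SeqL2

/-! ### The transition operator and its Dirichlet form -/

/-- A symmetric probability on `ℤ`, the law of the steps of the walk. -/
structure IsSymmStep (p : ℤ → ℝ) : Prop where
  nonneg : ∀ k, 0 ≤ p k
  total : HasSum p 1
  symm : ∀ k, p (-k) = p k

open SeqL2

/-- Convolution with `p`: the transition operator of the walk on `ℓ²(ℤ)`. -/
noncomputable def walkOp (p : ℤ → ℝ) : SeqL2 →L[ℝ] SeqL2 :=
  ∑' k, p k • (shift k).toContinuousLinearMap

namespace IsSymmStep

variable {p : ℤ → ℝ}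

theorem hasSum_walkOp (hp : IsSymmStep p) :
    HasSum (fun k => p k • (shift k).toContinuousLinearMap) (walkOp p) := by
  refine (Summable.of_norm_bounded hp.total.summable fun k => ?_).hasSum
  rw [norm_smul, Real.norm_of_nonneg (hp.nonneg k)]
  exact mul_le_of_le_one_right (hp.nonneg k) (LinearIsometry.norm_toContinuousLinearMap_le _)

theorem hasSum_walkOp_apply (hp : IsSymmStep p) (u : SeqL2) :
    HasSum (fun k => p k • shift k u) (walkOp p u) := by
  simpa using (ContinuousLinearMap.apply ℝ SeqL2 u).hasSum hp.hasSum_walkOp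

theorem hasSum_walkOp_apply' (hp : IsSymmStep p) (u : SeqL2) (x : ℤ) :
    HasSum (fun k => p k * u (x - k)) (walkOp p u x) := by
  have h := (lp.evalCLM ℝ (fun _ : ℤ => ℝ) 2 x).hasSum (hp.hasSum_walkOp_apply u)
  exact h.congr_fun fun k => rfl

theorem hasSum_walkOp_apply_sub (hp : IsSymmStep p) (u : SeqL2) (x : ℤ) :
    HasSum (fun y => p (x - y) * u y) (walkOp p u x) := by
  have h := (Equiv.subLeft x).hasSum_iff.2 (hp.hasSum_walkOp_apply' u x)
  simpa [Function.comp_def] using h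

theorem hasSum_inner (hp : IsSymmStep p) (u v : SeqL2) :
    HasSum (fun k => p k * inner ℝ u (shift k v)) (inner ℝ u (walkOp p v)) := by
  simpa [inner_smul_right] using (innerSL ℝ u).hasSum (hp.hasSum_walkOp_apply v)

theorem inner_walkOp (hp : IsSymmStep p) (u v : SeqL2) :
    inner ℝ (walkOp p u) v = inner ℝ u (walkOp p v) := by
  have h := (Equiv.neg ℤ).hasSum_iff.2 (hp.hasSum_inner v u)
  rw [real_inner_comm]
  refine h.unique ?_
  refine (hp.hasSum_inner u v).congr_fun fun k => ?_
  simp only [Function.comp_apply, Equiv.neg_apply, hp.symm]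
  rw [real_inner_comm, inner_shift_left, neg_neg]

theorem walkOp_mono (hp : IsSymmStep p) {u v : SeqL2} (h : ∀ x, u x ≤ v x) (x : ℤ) :
    walkOp p u x ≤ walkOp p v x :=
  hasSum_le (fun k => mul_le_mul_of_nonneg_left (h _) (hp.nonneg k))
    (hp.hasSum_walkOp_apply' u x) (hp.hasSum_walkOp_apply' v x)

theorem walkOp_nonneg (hp : IsSymmStep p) {u : SeqL2} (h : ∀ x, 0 ≤ u x) (x : ℤ) :
    0 ≤ walkOp p u x :=
  (hp.hasSum_walkOp_apply' u x).nonneg fun k => mul_nonneg (hp.nonneg k) (h _)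

/-- The Dirichlet form of the walk is the `p`-average of the squared increments. -/
theorem hasSum_energy (hp : IsSymmStep p) (u : SeqL2) :
    HasSum (fun k => p k * (‖shift k u - u‖ ^ 2 / 2)) (‖u‖ ^ 2 - inner ℝ u (walkOp p u)) := by
  have h := (hp.total.mul_right (‖u‖ ^ 2)).sub (hp.hasSum_inner u u)
  rw [one_mul] at h
  refine h.congr_fun fun k => ?_
  rw [norm_sub_sq_real, LinearIsometry.norm_map, real_inner_comm]
  ring

theorem energy_lower (hp : IsSymmStep p) (u : SeqL2) :
    p 1 * ‖shift 1 u - u‖ ^ 2 ≤ ‖u‖ ^ 2 - inner ℝ u (walkOp p u) := by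
  have h := sum_le_hasSum {1, -1} (fun k _ => mul_nonneg (hp.nonneg k) (by positivity))
    (hp.hasSum_energy u)
  rw [Finset.sum_pair (by norm_num), hp.symm] at h
  have h1 : ‖shift (-1) u - u‖ = ‖shift 1 u - u‖ := by
    rw [← LinearIsometry.norm_map (shift 1), map_sub, ← shift_add, norm_sub_rev]
    congr 2
    ext x; simp
  rw [h1] at h
  linarith

theorem energy_upper (hp : IsSymmStep p) {σ2 : ℝ}
    (hvar : HasSum (fun k : ℤ => (k : ℝ) ^ 2 * p k) σ2) (u : SeqL2) :
    ‖u‖ ^ 2 - inner ℝ u (walkOp p u) ≤ σ2 / 2 * ‖shift 1 u - u‖ ^ 2 := by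
  have h := hvar.mul_right (‖shift 1 u - u‖ ^ 2 / 2)
  refine (hasSum_le (fun k => ?_) (hp.hasSum_energy u) h).trans_eq (by ring)
  have hk := pow_le_pow_left₀ (norm_nonneg _) (norm_shift_sub_le u k) 2
  rw [mul_pow, sq_abs] at hk
  nlinarith [mul_le_mul_of_nonneg_left hk (hp.nonneg k)]

theorem norm_walkOp_le (hp : IsSymmStep p) (u : SeqL2) : ‖walkOp p u‖ ≤ ‖u‖ := by
  rw [← (hp.hasSum_walkOp_apply u).tsum_eq]
  refine tsum_of_norm_bounded (by simpa using hp.total.mul_right ‖u‖) fun k => ?_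
  rw [norm_smul, LinearIsometry.norm_map, Real.norm_of_nonneg (hp.nonneg k)]

end IsSymmStep

/-! ### Path sums as iterated operators -/

/-- The paths of `n` steps from `0` to `x`. -/
def pathsTo (n : ℕ) (x : ℤ) : Set (Fin (n + 1) → ℤ) :=
  {γ | γ 0 = 0 ∧ γ (Fin.last n) = x}

/-- A path of `n + 1` steps is a path of `n` steps together with its last point. -/
def pathsToSuccEquiv (n : ℕ) (x : ℤ) : (Σ y, pathsTo n y) ≃ pathsTo (n + 1) x where
  toFun γ := ⟨Fin.snoc (α := fun _ => ℤ) γ.2.1 x, by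
    have h0 := γ.2.2.1
    refine ⟨?_, by simp⟩
    rw [← Fin.castSucc_zero, Fin.snoc_castSucc, h0]⟩
  invFun γ := ⟨γ.1 (Fin.last n).castSucc, fun i => γ.1 i.castSucc, by
    have h0 := γ.2.1
    exact ⟨by simpa using h0, rfl⟩⟩
  left_inv := by
    rintro ⟨y, γ, h0, rfl⟩
    exact Sigma.subtype_ext (by simp) (funext fun i => by simp)
  right_inv := by
    rintro ⟨γ, h0, rfl⟩
    ext i
    induction i using Fin.lastCases <;> simp

/-- Feynman-Kac: iterating `u ↦ p * (W u)` from the unit mass at `0` sums the path weights in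
which every visited site but the last is weighted by `W`. -/
theorem hasSum_paths {p W : ℤ → ℝ} (hp : ∀ k, 0 ≤ p k) (hW : ∀ x, 0 ≤ W x) {H : ℕ → ℤ → ℝ}
    (h0 : ∀ x, H 0 x = if x = 0 then 1 else 0)
    (hs : ∀ n x, HasSum (fun y => p (x - y) * (W y * H n y)) (H (n + 1) x)) (n : ℕ) (x : ℤ) :
    HasSum (fun γ : pathsTo n x =>
      ∏ i : Fin n, (W (γ.1 i.castSucc) * p (γ.1 i.succ - γ.1 i.castSucc))) (H n x) := by
  induction n generalizing x with
  | zero =>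
    rw [h0]
    by_cases hx : x = 0
    · subst hx
      have : Unique (pathsTo 0 0) :=
        { default := ⟨fun _ => 0, rfl, rfl⟩
          uniq := fun γ => by
            ext i
            rw [Fin.fin_one_eq_zero i]
            exact γ.2.1 }
      simpa only [Fin.prod_univ_zero, Fintype.sum_unique, ↓reduceIte] using
        hasSum_fintype (fun γ : pathsTo 0 0 =>
        ∏ i : Fin 0, (W (γ.1 i.castSucc) * p (γ.1 i.succ - γ.1 i.castSucc)))
    · have : IsEmpty (pathsTo 0 x) := ⟨fun γ => hx (γ.2.2.symm.trans γ.2.1)⟩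
      simp only [if_neg hx]
      exact hasSum_empty
  | succ n ih =>
    rw [← (pathsToSuccEquiv n x).hasSum_iff]
    have hfib : ∀ y, HasSum (fun γ : pathsTo n y =>
        (∏ i : Fin n, (W (γ.1 i.castSucc) * p (γ.1 i.succ - γ.1 i.castSucc))) *
          (W y * p (x - y))) (H n y * (W y * p (x - y))) := fun y => (ih y).mul_right _
    have hval : ((fun γ : pathsTo (n + 1) x =>
        ∏ i : Fin (n + 1), (W (γ.1 i.castSucc) * p (γ.1 i.succ - γ.1 i.castSucc))) ∘
          pathsToSuccEquiv n x) = fun γ : Σ y, pathsTo n y =>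
        (∏ i : Fin n, (W (γ.2.1 i.castSucc) * p (γ.2.1 i.succ - γ.2.1 i.castSucc))) *
          (W γ.1 * p (x - γ.1)) := by
      ext ⟨y, γ, hγ0, rfl⟩
      simp only [Function.comp_apply, pathsToSuccEquiv, Equiv.coe_fn_mk]
      rw [Fin.prod_univ_castSucc]
      simp only [Fin.snoc_castSucc, Fin.succ_castSucc, Fin.succ_last, Fin.snoc_last]
    rw [hval]
    have hnn : ∀ γ : Σ y, pathsTo n y, 0 ≤
        (∏ i : Fin n, (W (γ.2.1 i.castSucc) * p (γ.2.1 i.succ - γ.2.1 i.castSucc))) *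
          (W γ.1 * p (x - γ.1)) := fun γ =>
      mul_nonneg (Finset.prod_nonneg fun i _ => mul_nonneg (hW _) (hp _))
        (mul_nonneg (hW _) (hp _))
    have hout : HasSum (fun y => H n y * (W y * p (x - y))) (H (n + 1) x) :=
      (hs n x).congr_fun fun y => by ring
    refine HasSum.sigma_of_hasSum hout hfib ((summable_sigma_of_nonneg hnn).2
      ⟨fun y => (hfib y).summable, ?_⟩)
    exact hout.summable.congr fun y => (hfib y).tsum_eq.symm

/-- The site weights of the pinned walk above the wall: `0` below `-j`, `exp ε` at the origin
and `1` elsewhere. -/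
noncomputable def siteWeight (j : ℕ) (ε : ℝ) (x : ℤ) : ℝ :=
  if x < -(j : ℤ) then 0 else if x = 0 then Real.exp ε else 1

theorem siteWeight_nonneg (j : ℕ) (ε : ℝ) (x : ℤ) : 0 ≤ siteWeight j ε x := by
  unfold siteWeight; split_ifs <;> positivity

theorem siteWeight_zero (j : ℕ) (ε : ℝ) : siteWeight j ε 0 = Real.exp ε := by
  simp [siteWeight]

theorem abs_siteWeight_le (j : ℕ) (ε : ℝ) (x : ℤ) : |siteWeight j ε x| ≤ Real.exp |ε| := by
  rw [abs_of_nonneg (siteWeight_nonneg j ε x)]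
  unfold siteWeight
  split_ifs
  · positivity
  · exact Real.exp_le_exp.2 (le_abs_self ε)
  · exact Real.one_le_exp (abs_nonneg ε)

theorem siteWeight_eq_zero {j : ℕ} {ε : ℝ} {x : ℤ} (hx : x < -(j : ℤ)) :
    siteWeight j ε x = 0 := if_pos hx

theorem siteWeight_of_le {j : ℕ} {ε : ℝ} {x : ℤ} (hx : -(j : ℤ) ≤ x) :
    siteWeight j ε x = if x = 0 then Real.exp ε else 1 := if_neg (not_lt.2 hx)

/-- Multiplication by the site weights. -/
noncomputable def siteOp (j : ℕ) (ε : ℝ) : SeqL2 →L[ℝ] SeqL2 :=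
  mulOp (siteWeight j ε) (Real.exp |ε|) (abs_siteWeight_le j ε)

@[simp] theorem siteOp_apply (j : ℕ) (ε : ℝ) (u : SeqL2) (x : ℤ) :
    siteOp j ε u x = siteWeight j ε x * u x := rfl

/-- The weight profile of the free walk after `n` steps from the origin. -/
noncomputable def freeProfile (p : ℤ → ℝ) (n : ℕ) : SeqL2 := (walkOp p)^[n] delta

/-- The weight profile of the pinned walk above the wall after `n` steps from the origin; the
sites at the times `0, …, n - 1` are weighted. -/
noncomputable def pinnedProfile (p : ℤ → ℝ) (j : ℕ) (ε : ℝ) (n : ℕ) : SeqL2 :=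
  (fun u => walkOp p (siteOp j ε u))^[n] delta

theorem freeProfile_succ (p : ℤ → ℝ) (n : ℕ) :
    freeProfile p (n + 1) = walkOp p (freeProfile p n) := Function.iterate_succ_apply' _ _ _

theorem pinnedProfile_succ (p : ℤ → ℝ) (j : ℕ) (ε : ℝ) (n : ℕ) :
    pinnedProfile p j ε (n + 1) = walkOp p (siteOp j ε (pinnedProfile p j ε n)) :=
  Function.iterate_succ_apply' _ _ _

theorem contacts_succ {n : ℕ} (γ : Fin (n + 2) → ℤ) :
    contacts γ = (Finset.univ.filter fun i : Fin n => γ i.succ.castSucc = 0).card := by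
  rw [contacts, Finset.card_filter, Finset.card_filter, Fin.sum_univ_castSucc, Fin.sum_univ_succ]
  simp

/-- On bridges, the site weights count the contacts and cut out the paths below the wall. The
factor `exp ε` is the weight of the starting point, which is not counted as a contact. -/
theorem prod_siteWeight {p : ℤ → ℝ} (j : ℕ) (ε : ℝ) {n : ℕ} {γ : Fin (n + 2) → ℤ}
    (hγ : γ ∈ bridges (n + 1)) :
    ∏ i : Fin (n + 1), (siteWeight j ε (γ i.castSucc) * p (γ i.succ - γ i.castSucc)) =
      Real.exp ε * (bridgesAbove j (n + 1)).indicator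
        (fun γ => Real.exp (ε * (contacts γ : ℝ)) * pathWeight p γ) γ := by
  rw [Finset.prod_mul_distrib]
  by_cases h : γ ∈ bridgesAbove j (n + 1)
  · rw [Set.indicator_of_mem h, ← mul_assoc]
    change _ * pathWeight p γ = _
    congr 1
    rw [Fin.prod_univ_succ, Fin.castSucc_zero, hγ.1, siteWeight_zero, contacts_succ]
    congr 1
    rw [mul_comm, Real.exp_nat_mul, ← Finset.prod_const, Finset.prod_filter]
    exact Finset.prod_congr rfl fun i _ => siteWeight_of_le (h.2 _)
  · rw [Set.indicator_of_notMem h, mul_zero]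
    have : ∃ i, γ i < -(j : ℤ) := by
      by_contra! hcon
      exact h ⟨hγ, hcon⟩
    obtain ⟨i, hi⟩ := this
    have hlast : i ≠ Fin.last (n + 1) := by
      rintro rfl
      rw [hγ.2] at hi
      omega
    obtain ⟨k, rfl⟩ := Fin.exists_castSucc_eq.2 hlast
    rw [Finset.prod_eq_zero (Finset.mem_univ k) (siteWeight_eq_zero hi), zero_mul]

section

variable {p : ℤ → ℝ}

theorem IsSymmStep.freeProfile_nonneg (hp : IsSymmStep p) (n : ℕ) (x : ℤ) :
    0 ≤ freeProfile p n x := by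
  induction n generalizing x with
  | zero => simp only [freeProfile, Function.iterate_zero, id, delta_apply]; split_ifs <;> simp
  | succ n ih => rw [freeProfile_succ]; exact hp.walkOp_nonneg ih x

theorem IsSymmStep.pinnedProfile_nonneg (hp : IsSymmStep p) (j : ℕ) (ε : ℝ) (n : ℕ) (x : ℤ) :
    0 ≤ pinnedProfile p j ε n x := by
  induction n generalizing x with
  | zero => simp only [pinnedProfile, Function.iterate_zero, id, delta_apply]; split_ifs <;> simp
  | succ n ih =>
    rw [pinnedProfile_succ]
    exact hp.walkOp_nonneg (fun x => mul_nonneg (siteWeight_nonneg _ _ _) (ih x)) x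

theorem IsSymmStep.partitionFn_eq (hp : IsSymmStep p) (L : ℕ) :
    partitionFn p L = freeProfile p L 0 := by
  have h := hasSum_paths (p := p) (W := fun _ => 1) (H := fun n x => freeProfile p n x)
    hp.nonneg (fun _ => zero_le_one) delta_apply (fun n x => by
      simp only [one_mul, freeProfile_succ]
      exact hp.hasSum_walkOp_apply_sub _ x) L 0
  simp only [one_mul] at h
  exact h.tsum_eq

/-- The pinned partition function above the wall is an entry of the iterated operator. -/
theorem IsSymmStep.hasSum_pinned (hp : IsSymmStep p) (j : ℕ) (ε : ℝ) (n : ℕ) :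
    HasSum (fun γ : bridgesAbove j (n + 1) =>
      Real.exp (ε * (contacts γ.1 : ℝ)) * pathWeight p γ.1)
      (Real.exp (-ε) * pinnedProfile p j ε (n + 1) 0) := by
  have h : HasSum (fun γ : bridges (n + 1) => ∏ i : Fin (n + 1),
      (siteWeight j ε (γ.1 i.castSucc) * p (γ.1 i.succ - γ.1 i.castSucc)))
      (pinnedProfile p j ε (n + 1) 0) := hasSum_paths (H := fun n x => pinnedProfile p j ε n x)
    hp.nonneg (siteWeight_nonneg j ε) delta_apply (fun n x => by
      rw [pinnedProfile_succ]
      exact hp.hasSum_walkOp_apply_sub _ x) (n + 1) 0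
  have h2 := h.mul_left (Real.exp (-ε))
  have h3 : HasSum ((bridgesAbove j (n + 1)).indicator
      (fun γ => Real.exp (ε * (contacts γ : ℝ)) * pathWeight p γ) ∘
        ((↑) : bridges (n + 1) → (Fin (n + 2) → ℤ)))
      (Real.exp (-ε) * pinnedProfile p j ε (n + 1) 0) := by
    refine h2.congr_fun fun γ => ?_
    have := prod_siteWeight (p := p) j ε γ.2
    rw [Function.comp_apply, this, ← mul_assoc, ← Real.exp_add]
    simp
  rw [hasSum_subtype_iff_indicator, Set.indicator_indicator,
    Set.inter_eq_right.2 (fun γ hγ => hγ.1)] at h3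
  exact (hasSum_subtype_iff_indicator (f := fun γ : Fin (n + 2) → ℤ =>
    Real.exp (ε * (contacts γ : ℝ)) * pathWeight p γ)).2 h3

theorem IsSymmStep.expectAbove_succ (hp : IsSymmStep p) (j : ℕ) (ε : ℝ) (n : ℕ) :
    expectAbove p j (n + 1) (fun γ => Real.exp (ε * (contacts γ : ℝ))) =
      Real.exp (-ε) * pinnedProfile p j ε (n + 1) 0 / partitionFnAbove p j (n + 1) := by
  rw [← ((hp.hasSum_pinned j ε n).div_const _).tsum_eq]
  simp [expectAbove, lawAbove, mul_div_assoc]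

theorem IsSymmStep.summable_bridgesAbove (hp : IsSymmStep p) (j L : ℕ) :
    Summable fun γ : bridgesAbove j L => pathWeight p γ.1 :=
  (summable_pathWeight hp.nonneg hp.total.summable L).comp_injective
    (i := fun γ : bridgesAbove j L => (⟨γ.1, γ.2.1⟩ : bridges L)) fun γ γ' h => by
      ext1; simpa using h

theorem IsSymmStep.pathWeight_nonneg (hp : IsSymmStep p) {L : ℕ} (γ : Fin (L + 1) → ℤ) :
    0 ≤ pathWeight p γ := Finset.prod_nonneg fun _ _ => hp.nonneg _

/-- The constant path has positive weight. -/
theorem IsSymmStep.partitionFnAbove_pos (hp : IsSymmStep p) (h0 : 0 < p 0) (j L : ℕ) :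
    0 < partitionFnAbove p j L := by
  refine (hp.summable_bridgesAbove j L).tsum_pos (fun γ => hp.pathWeight_nonneg _)
    ⟨fun _ => 0, ⟨rfl, rfl⟩, fun _ => by simp⟩ ?_
  simp [pathWeight, h0]

theorem IsSymmStep.partitionFnAbove_le (hp : IsSymmStep p) (j L : ℕ) :
    partitionFnAbove p j L ≤ partitionFn p L :=
  Summable.tsum_le_tsum_of_inj (fun γ : bridgesAbove j L => (⟨γ.1, γ.2.1⟩ : bridges L))
    (fun γ γ' h => by ext1; simpa using h) (fun γ _ => hp.pathWeight_nonneg _)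
    (fun γ => le_rfl) (hp.summable_bridgesAbove j L)
    (summable_pathWeight hp.nonneg hp.total.summable L)

theorem IsSymmStep.expectAbove_zero (hp : IsSymmStep p) (h0 : 0 < p 0) (j : ℕ) (ε : ℝ) :
    expectAbove p j 0 (fun γ => Real.exp (ε * (contacts γ : ℝ))) = 1 := by
  have hc : ∀ γ : Fin (0 + 1) → ℤ, contacts γ = 0 := fun γ => by simp [contacts]
  simp only [expectAbove, lawAbove, hc, Nat.cast_zero, mul_zero, Real.exp_zero, one_mul]
  rw [tsum_div_const]
  exact div_self (hp.partitionFnAbove_pos h0 j 0).ne'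

/-- Raising the reward raises the pinned expectation. -/
theorem IsSymmStep.pinned_mono (hp : IsSymmStep p) (j n : ℕ) {ε ε' : ℝ} (h : ε ≤ ε') :
    Real.exp (-ε) * pinnedProfile p j ε (n + 1) 0 ≤
      Real.exp (-ε') * pinnedProfile p j ε' (n + 1) 0 :=
  hasSum_le (fun γ => mul_le_mul_of_nonneg_right (Real.exp_le_exp.2 (by gcongr))
    (hp.pathWeight_nonneg _)) (hp.hasSum_pinned j ε n) (hp.hasSum_pinned j ε' n)

end

theorem WalkClass.isSymmStep {c₀ σ2 : ℝ} {p : ℤ → ℝ} (h : WalkClass c₀ σ2 p) : IsSymmStep p :=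
  ⟨h.nonneg, h.total, h.symm⟩

/-- Chebyshev: the walk stays put with probability at least `1 - σ²`. -/
theorem WalkClass.one_sub_le {c₀ σ2 : ℝ} {p : ℤ → ℝ} (h : WalkClass c₀ σ2 p) :
    1 - σ2 ≤ p 0 := by
  have hs := (h.variance.sub h.total).add (hasSum_ite_eq (0 : ℤ) (p 0))
  have := hs.nonneg fun k => by
    by_cases hk : k = 0
    · simp [hk]
    · have h1 : (1 : ℝ) ≤ (k : ℝ) ^ 2 := by
        have : 1 ≤ k ^ 2 := by have := sq_pos_of_ne_zero hk (a := k); omega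
        exact_mod_cast this
      simp only [if_neg hk, add_zero]
      nlinarith [h.nonneg k]
  linarith

/-! ### Return probabilities of the free walk -/

namespace IsSymmStep

variable {p : ℤ → ℝ}

theorem inner_freeProfile (hp : IsSymmStep p) (n : ℕ) (u : SeqL2) :
    inner ℝ (freeProfile p n) u = (walkOp p)^[n] u 0 := by
  induction n generalizing u with
  | zero => exact inner_delta_left u
  | succ n ih => rw [freeProfile_succ, hp.inner_walkOp, ih, Function.iterate_succ_apply]

theorem inner_freeProfile_freeProfile (hp : IsSymmStep p) (m n : ℕ) :
    inner ℝ (freeProfile p m) (freeProfile p n) = freeProfile p (m + n) 0 := by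
  rw [hp.inner_freeProfile, freeProfile, freeProfile, Function.iterate_add_apply]

theorem antitone_norm_freeProfile (hp : IsSymmStep p) : Antitone fun n => ‖freeProfile p n‖ :=
  antitone_nat_of_succ_le fun n => by rw [freeProfile_succ]; exact hp.norm_walkOp_le _

theorem freeProfile_le_even (hp : IsSymmStep p) {i m : ℕ} (h : 2 * i ≤ m) :
    freeProfile p m 0 ≤ freeProfile p (2 * i) 0 := by
  obtain ⟨k, rfl⟩ := Nat.exists_eq_add_of_le h
  have h1 : 2 * i + k = i + (i + k) := by ring
  rw [h1, ← hp.inner_freeProfile_freeProfile, two_mul, ← hp.inner_freeProfile_freeProfile,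
    real_inner_self_eq_norm_sq, sq]
  exact (real_inner_le_norm _ _).trans
    (mul_le_mul_of_nonneg_left (hp.antitone_norm_freeProfile (by simp)) (norm_nonneg _))

theorem freeProfile_le_one (hp : IsSymmStep p) (m : ℕ) : freeProfile p m 0 ≤ 1 :=
  (hp.freeProfile_le_even (i := 0) (by simp)).trans (by simp [freeProfile, delta_apply])

theorem sum_freeProfile_le_one (hp : IsSymmStep p) (n : ℕ) (s : Finset ℤ) :
    ∑ x ∈ s, freeProfile p n x ≤ 1 := by
  induction n generalizing s with
  | zero =>
    simp only [freeProfile, Function.iterate_zero, id, delta_apply, Finset.sum_ite_eq']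
    split_ifs <;> simp
  | succ n ih =>
    simp only [freeProfile_succ]
    have h := hasSum_sum (s := s) fun x _ => hp.hasSum_walkOp_apply' (freeProfile p n) x
    refine hasSum_le (fun k => ?_) h hp.total
    rw [← Finset.mul_sum]
    refine mul_le_of_le_one_right (hp.nonneg k) ?_
    rw [← Finset.sum_image (f := fun y => freeProfile p n y) (g := fun x => x - k)
      (fun a _ b _ hab => by simpa using hab)]
    exact ih _

/-- The Green function `g` of a walk killed outside a set has Dirichlet energy at most `g 0`:
up to the time horizon it solves `(1 - P) g = δ` on the set. The projection `M` restricts to the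
set, and `t` is the profile of the killed walk. -/
theorem green_energy_le (hp : IsSymmStep p) (M : SeqL2 →L[ℝ] SeqL2)
    (hM : ∀ u v, inner ℝ (M u) v = inner ℝ u (M v)) (hMM : ∀ u, M (M u) = M u)
    (hδ : M delta = delta) {t : ℕ → SeqL2} (h0 : t 0 = delta)
    (ht : ∀ n, t (n + 1) = walkOp p (M (t n))) (hnn : ∀ n x, 0 ≤ M (t n) x) (n : ℕ) :
    p 1 * ‖shift 1 (∑ i ∈ Finset.range n, M (t i)) - ∑ i ∈ Finset.range n, M (t i)‖ ^ 2 ≤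
      ∑ i ∈ Finset.range n, M (t i) 0 := by
  set g := ∑ i ∈ Finset.range n, M (t i) with hg
  have hg0 : g 0 = ∑ i ∈ Finset.range n, M (t i) 0 := by rw [hg, lp.coeFn_sum, Finset.sum_apply]
  have hgx : ∀ x, 0 ≤ g x := fun x => by
    rw [hg, lp.coeFn_sum, Finset.sum_apply]; exact Finset.sum_nonneg fun i _ => hnn i x
  have hMg : M g = g := by simp only [hg, map_sum, hMM]
  have hPg : M (walkOp p g) = g - delta + M (t n) := by
    simp only [hg, map_sum, ← ht]
    have := Finset.sum_range_succ' (fun i => M (t i)) n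
    rw [Finset.sum_range_succ, h0, hδ] at this
    rw [sub_add_eq_add_sub, this, add_sub_cancel_right]
  have hkey : ‖g‖ ^ 2 - inner ℝ g (walkOp p g) = g 0 - inner ℝ g (M (t n)) := by
    have : inner ℝ g (walkOp p g) = inner ℝ g (M (walkOp p g)) := by rw [← hM, hMg]
    rw [this, hPg, inner_add_right, inner_sub_right, inner_delta_right,
      real_inner_self_eq_norm_sq]
    ring
  have := hp.energy_lower g
  rw [hkey, hg0] at this
  linarith [inner_nonneg hgx (hnn n)]

/-- The expected number of visits to the origin in `n` steps is `O(√n / σ)`: choose `R` of order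
`σ √n`. -/
theorem sum_freeProfile_zero_le (hp : IsSymmStep p) (h1 : 0 < p 1) (n : ℕ) {R : ℕ} (hR : 0 < R) :
    ∑ k ∈ Finset.range n, freeProfile p k 0 ≤ 2 * n / R + R / p 1 := by
  have hE := hp.green_energy_le (ContinuousLinearMap.id ℝ SeqL2) (fun _ _ => rfl) (fun _ => rfl)
    rfl (t := freeProfile p) rfl (freeProfile_succ p) hp.freeProfile_nonneg n
  simp only [ContinuousLinearMap.id_apply] at hE
  set g : SeqL2 := ∑ k ∈ Finset.range n, freeProfile p k with hg
  have hgx : ∀ x, g x = ∑ k ∈ Finset.range n, freeProfile p k x := fun x => by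
    rw [hg, lp.coeFn_sum, Finset.sum_apply]
  rw [← hgx] at hE ⊢
  have hR' : (0 : ℝ) < R := by exact_mod_cast hR
  have hg0 : 0 ≤ g 0 := by rw [hgx]; exact Finset.sum_nonneg fun k _ => hp.freeProfile_nonneg k 0
  have hmass : ∑ i ∈ Finset.range R, g (i : ℤ) ≤ n := by
    simp only [hgx]
    rw [Finset.sum_comm]
    calc _ ≤ ∑ _k ∈ Finset.range n, (1 : ℝ) := Finset.sum_le_sum fun k _ => by
          have := hp.sum_freeProfile_le_one k ((Finset.range R).image ((↑) : ℕ → ℤ))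
          rwa [Finset.sum_image (fun a _ b _ hab => by simpa using hab)] at this
      _ = n := by simp
  -- the gradient bound and the inequality of arithmetic and geometric means
  have hdiff : ∀ i ∈ Finset.range R, g 0 - (g 0 / 2 + R / (2 * p 1)) ≤ g (i : ℤ) := by
    intro i hi
    have hd := sub_sq_le g 0 i
    rw [zero_add] at hd
    have hi' : (i : ℝ) ≤ R := by exact_mod_cast (Finset.mem_range.1 hi).le
    have h2 : (g i - g 0) ^ 2 ≤ R * (g 0 / p 1) := by
      refine hd.trans (mul_le_mul hi' ?_ (sq_nonneg _) hR'.le)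
      rw [le_div_iff₀ h1]; linarith
    have h3 : (g 0 - g i) ^ 2 ≤ (g 0 / 2 + R / (2 * p 1)) ^ 2 := by
      have h4 : (g 0 / 2 + R / (2 * p 1)) ^ 2 =
          R * (g 0 / p 1) + (g 0 / 2 - R / (2 * p 1)) ^ 2 := by field_simp; ring
      rw [h4]
      nlinarith [sq_nonneg (g 0 / 2 - R / (2 * p 1))]
    have := abs_le_of_sq_le_sq' h3 (by positivity)
    linarith [this.2]
  have hsum := Finset.sum_le_sum hdiff
  rw [Finset.sum_const, Finset.card_range, nsmul_eq_mul] at hsum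
  have h5 := hsum.trans hmass
  have h6 : (R : ℝ) * (2 * n / R + R / p 1) = 2 * n + R * (R / p 1) := by field_simp
  have h7 : (R : ℝ) / (2 * p 1) = R / p 1 / 2 := by field_simp
  refine le_of_mul_le_mul_left ?_ hR'
  rw [h6]
  rw [h7] at h5
  linarith

theorem half_mul_freeProfile_le (hp : IsSymmStep p) (m : ℕ) :
    (m : ℝ) / 2 * freeProfile p m 0 ≤ ∑ k ∈ Finset.range (m + 1), freeProfile p k 0 := by
  have h1 : ∑ _i ∈ Finset.range (m / 2 + 1), freeProfile p m 0 ≤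
      ∑ k ∈ Finset.range (m + 1), freeProfile p k 0 := by
    calc _ ≤ ∑ i ∈ Finset.range (m / 2 + 1), freeProfile p (2 * i) 0 :=
          Finset.sum_le_sum fun i hi => hp.freeProfile_le_even (by
            have := Finset.mem_range.1 hi; omega)
      _ = ∑ k ∈ (Finset.range (m / 2 + 1)).image (2 * ·), freeProfile p k 0 :=
          (Finset.sum_image (f := fun k => freeProfile p k 0) (g := fun i => 2 * i)
            (fun a _ b _ hab => by simpa using hab)).symm
      _ ≤ _ := Finset.sum_le_sum_of_subset_of_nonneg (fun k hk => by
            simp only [Finset.mem_image, Finset.mem_range] at hk ⊢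
            omega) fun k _ _ => hp.freeProfile_nonneg k 0
  refine le_trans ?_ h1
  rw [Finset.sum_const, Finset.card_range, nsmul_eq_mul]
  refine mul_le_mul_of_nonneg_right ?_ (hp.freeProfile_nonneg m 0)
  have : m ≤ 2 * (m / 2 + 1) := by omega
  have : (m : ℝ) ≤ 2 * ((m / 2 + 1 : ℕ) : ℝ) := by exact_mod_cast this
  linarith

theorem mul_freeProfile_le_succ (hp : IsSymmStep p) (n : ℕ) :
    p 0 * freeProfile p n 0 ≤ freeProfile p (n + 1) 0 := by
  rw [freeProfile_succ]
  simpa using le_hasSum (hp.hasSum_walkOp_apply' (freeProfile p n) 0) 0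
    fun k _ => mul_nonneg (hp.nonneg k) (hp.freeProfile_nonneg n _)

end IsSymmStep

theorem truncated_parabola_eq_zero {R : ℕ} {x : ℤ} (hx : x ∉ Finset.Icc (-(R : ℤ)) R) :
    max 0 ((R : ℝ) ^ 2 - (x : ℝ) ^ 2) = 0 := by
  rw [Finset.mem_Icc, ← abs_le, not_le] at hx
  have hx' : (R : ℝ) ≤ |(x : ℝ)| := by exact_mod_cast hx.le
  refine max_eq_left ?_
  rw [sub_nonpos, ← sq_abs (x : ℝ)]
  exact pow_le_pow_left₀ (Nat.cast_nonneg _) hx' 2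

/-- The truncated parabola `(R² - x²)⁺`. -/
noncomputable def parabola (R : ℕ) : SeqL2 :=
  ⟨fun x => max 0 ((R : ℝ) ^ 2 - (x : ℝ) ^ 2),
    memℓp_two_of_support (Finset.Icc (-(R : ℤ)) R) fun _ hx =>
      truncated_parabola_eq_zero hx⟩

theorem parabola_apply (R : ℕ) (x : ℤ) :
    parabola R x = max 0 ((R : ℝ) ^ 2 - (x : ℝ) ^ 2) := rfl

namespace WalkClass

variable {c₀ σ2 : ℝ} {p : ℤ → ℝ}

theorem sqrt_mul_freeProfile_le (h : WalkClass c₀ σ2 p) (hc : 0 < c₀) (hc' : c₀ ≤ 1)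
    (hσ : 0 < σ2) (m : ℕ) :
    Real.sqrt (σ2 * m) * freeProfile p m 0 ≤ 18 / c₀ := by
  have hp := h.isSymmStep
  set y := Real.sqrt (σ2 * m) with hy
  have hy2 : y ^ 2 = σ2 * m := Real.sq_sqrt (by positivity)
  have hy0 : 0 ≤ y := Real.sqrt_nonneg _
  have hz0 := hp.freeProfile_nonneg m 0
  rcases le_or_gt y 1 with hy1 | hy1
  · have h1 : y * freeProfile p m 0 ≤ 1 := mul_le_one₀ hy1 hz0 (hp.freeProfile_le_one m)
    refine h1.trans ?_
    rw [le_div_iff₀ hc]; linarith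
  set τ := Real.sqrt (σ2 * (m + 1 : ℕ)) with hτ
  have hτ2 : τ ^ 2 = σ2 * (m + 1 : ℕ) := Real.sq_sqrt (by positivity)
  have hyτ : y ≤ τ := Real.sqrt_le_sqrt (by push_cast; nlinarith)
  have hτ0 : 0 < τ := by linarith
  have hm : 1 ≤ m := by
    by_contra! hm
    have : m = 0 := by omega
    subst this
    simp at hy2
    nlinarith
  have hm' : (1 : ℝ) ≤ m := by exact_mod_cast hm
  have hτy : τ ≤ 3 / 2 * y := by
    refine le_of_sq_le_sq ?_ (by positivity)
    rw [mul_pow, hτ2, hy2]; push_cast; nlinarith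
  have hR1 := Nat.le_ceil τ
  have hR2 := Nat.ceil_lt_add_one hτ0.le
  have hp1 : c₀ * σ2 / 2 ≤ p 1 := h.one_step
  have hq : 0 < c₀ * σ2 / 2 := by positivity
  have hg := hp.sum_freeProfile_zero_le (hq.trans_le hp1) (m + 1) (Nat.ceil_pos.2 hτ0)
  have hz := hp.half_mul_freeProfile_le m
  have hb1 : 2 * ((m + 1 : ℕ) : ℝ) / (⌈τ⌉₊ : ℝ) ≤ 2 * τ / σ2 := by
    rw [div_le_div_iff₀ (by linarith) hσ]
    nlinarith
  have hb2 : (⌈τ⌉₊ : ℝ) / p 1 ≤ 2 * τ / (c₀ * σ2 / 2) :=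
    div_le_div₀ (by positivity) (by linarith) hq hp1
  have hb3 : 2 * τ / σ2 ≤ 2 * τ / (c₀ * σ2) :=
    div_le_div_of_nonneg_left (by positivity) (by positivity) (by nlinarith)
  have hb4 : 2 * τ / (c₀ * σ2) + 2 * τ / (c₀ * σ2 / 2) = 6 * τ / (c₀ * σ2) := by
    field_simp; ring
  have hmain : (m : ℝ) / 2 * freeProfile p m 0 ≤ 6 * τ / (c₀ * σ2) := by linarith
  rw [le_div_iff₀ (by positivity)] at hmain
  rw [le_div_iff₀ hc]
  have : y * (y * freeProfile p m 0 * c₀) ≤ y * 18 := by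
    have e : y * (y * freeProfile p m 0 * c₀) =
        2 * ((m : ℝ) / 2 * freeProfile p m 0 * (c₀ * σ2)) := by
      linear_combination (freeProfile p m 0 * c₀) * hy2
    rw [e]
    linarith
  exact le_of_mul_le_mul_left this (by linarith)

/-- One step of the walk lowers the truncated parabola by at most `σ²`. -/
theorem parabola_sub_le (h : WalkClass c₀ σ2 p) (R : ℕ) (x : ℤ) :
    parabola R x - σ2 ≤ walkOp p (parabola R) x := by
  have hp := h.isSymmStep
  have hσ : 0 ≤ σ2 := h.variance.nonneg fun k => mul_nonneg (sq_nonneg _) (h.nonneg k)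
  rw [parabola_apply]
  rcases le_total ((R : ℝ) ^ 2 - (x : ℝ) ^ 2) 0 with hx | hx
  · rw [max_eq_left hx]
    have := hp.walkOp_nonneg (u := parabola R) (fun y => le_max_left _ _) x
    linarith
  rw [max_eq_right hx]
  -- averaging the steps `k` and `-k` cancels the linear term of the parabola
  have h1 := hp.hasSum_walkOp_apply' (parabola R) x
  have h2 := (Equiv.neg ℤ).hasSum_iff.2 h1
  have h3 := (h1.add h2).mul_left (1 / 2)
  have h4 := (h.total.mul_right ((R : ℝ) ^ 2 - (x : ℝ) ^ 2)).sub h.variance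
  have h5 := hasSum_le (fun k => ?_) h4 h3
  · linarith
  simp only [Function.comp_apply, Equiv.neg_apply, h.symm, parabola_apply]
  have e1 := le_max_right (0 : ℝ) ((R : ℝ) ^ 2 - ((x - k : ℤ) : ℝ) ^ 2)
  have e2 := le_max_right (0 : ℝ) ((R : ℝ) ^ 2 - ((x - -k : ℤ) : ℝ) ^ 2)
  have e3 := mul_le_mul_of_nonneg_left (add_le_add e1 e2) (h.nonneg k)
  push_cast at e3 ⊢
  nlinarith

theorem parabola_sub_le_iterate (h : WalkClass c₀ σ2 p) (R n : ℕ) (x : ℤ) :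
    parabola R x - n * σ2 ≤ (walkOp p)^[n] (parabola R) x := by
  have hp := h.isSymmStep
  induction n generalizing x with
  | zero => simp
  | succ n ih =>
    rw [Function.iterate_succ_apply']
    have h1 := (hp.hasSum_walkOp_apply' (parabola R) x).sub (hp.total.mul_right (n * σ2))
    have h2 := hasSum_le (fun k => ?_) h1
      (hp.hasSum_walkOp_apply' ((walkOp p)^[n] (parabola R)) x)
    · have := h.parabola_sub_le R x
      push_cast
      linarith
    rw [← mul_sub]
    exact mul_le_mul_of_nonneg_left (ih _) (hp.nonneg k)

/-- The walk is within distance `R` of the origin at time `n` with probability at least `1 / 2`,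
so Cauchy-Schwarz bounds the return probability at time `2 n` from below. -/
theorem one_le_freeProfile_two_mul (h : WalkClass c₀ σ2 p) {n R : ℕ} (hR : 0 < R)
    (hnR : 2 * (n * σ2) ≤ (R : ℝ) ^ 2) :
    1 ≤ 4 * (2 * R + 1) * freeProfile p (2 * n) 0 := by
  have hp := h.isSymmStep
  have hR' : (0 : ℝ) < R := by exact_mod_cast hR
  have h1 := h.parabola_sub_le_iterate R n 0
  have hq0 : parabola R 0 = (R : ℝ) ^ 2 := by
    rw [parabola_apply]; simp
  rw [← hp.inner_freeProfile, hq0, real_inner_comm,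
    inner_eq_sum (s := Finset.Icc (-(R : ℤ)) R) (fun x hx => truncated_parabola_eq_zero hx)] at h1
  have h2 := Finset.sum_mul_sq_le_sq_mul_sq (Finset.Icc (-(R : ℤ)) R) (fun x => parabola R x)
    (fun x => freeProfile p n x)
  have h3 : ∑ x ∈ Finset.Icc (-(R : ℤ)) R, parabola R x ^ 2 ≤ (2 * R + 1) * (R : ℝ) ^ 4 := by
    calc _ ≤ ∑ _x ∈ Finset.Icc (-(R : ℤ)) R, (R : ℝ) ^ 4 := Finset.sum_le_sum fun x _ => by
          have e0 : 0 ≤ parabola R x := le_max_left _ _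
          have e1 : parabola R x ≤ (R : ℝ) ^ 2 :=
            max_le (sq_nonneg _) (by linarith [sq_nonneg (x : ℝ)])
          calc _ ≤ ((R : ℝ) ^ 2) ^ 2 := pow_le_pow_left₀ e0 e1 2
            _ = _ := by ring
      _ = _ := by
          rw [Finset.sum_const, Int.card_Icc, nsmul_eq_mul]
          congr 1
          have : ((R : ℤ) + 1 - -(R : ℤ)).toNat = 2 * R + 1 := by omega
          rw [this]; push_cast; ring
  have h4 := sum_sq_le (freeProfile p n) (Finset.Icc (-(R : ℤ)) R)
  rw [← real_inner_self_eq_norm_sq, hp.inner_freeProfile_freeProfile, ← two_mul] at h4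
  have h5 : ((R : ℝ) ^ 2 / 2) ^ 2 ≤
      ((2 * R + 1) * (R : ℝ) ^ 4) * freeProfile p (2 * n) 0 :=
    (pow_le_pow_left₀ (by positivity) (by linarith) 2).trans (h2.trans
      (mul_le_mul h3 h4 (Finset.sum_nonneg fun _ _ => sq_nonneg _) (by positivity)))
  refine le_of_mul_le_mul_left (a := (R : ℝ) ^ 4 / 4) ?_ (by positivity)
  linarith

theorem one_le_mul_freeProfile (h : WalkClass c₀ σ2 p) (hσ : 0 < σ2) (hσ' : σ2 ≤ 1 / 2)
    (L : ℕ) : 1 ≤ 40 * (1 + Real.sqrt (σ2 * L)) * freeProfile p L 0 := by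
  have hp := h.isSymmStep
  set y := Real.sqrt (σ2 * L) with hy
  have hy2 : y ^ 2 = σ2 * L := Real.sq_sqrt (by positivity)
  have hy0 : 0 ≤ y := Real.sqrt_nonneg _
  have hR1 := Nat.le_ceil y
  have hR2 := Nat.ceil_lt_add_one hy0
  have hL : 2 * ((L / 2 : ℕ) : ℝ) ≤ L := by exact_mod_cast Nat.mul_div_le L 2
  have h1 := h.one_le_freeProfile_two_mul (n := L / 2) (R := ⌈y⌉₊ + 1) (by omega) (by
    push_cast; nlinarith)
  have hz0 := hp.freeProfile_nonneg (2 * (L / 2)) 0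
  have h2 : freeProfile p (2 * (L / 2)) 0 ≤ 2 * freeProfile p L 0 := by
    have h0 := h.one_sub_le
    rcases Nat.even_or_odd' L with ⟨k, rfl | rfl⟩
    · have : 2 * (2 * k / 2) = 2 * k := by omega
      rw [this] at hz0 ⊢
      linarith
    · have : 2 * ((2 * k + 1) / 2) = 2 * k := by omega
      rw [this] at hz0 ⊢
      have := hp.mul_freeProfile_le_succ (2 * k)
      nlinarith
  have h3 : (4 * (2 * ((⌈y⌉₊ + 1 : ℕ) : ℝ) + 1)) ≤ 20 * (1 + y) := by push_cast; linarith
  have h4 := mul_le_mul h3 h2 hz0 (by positivity)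
  linarith

/-- The return probabilities are doubling, with a constant that depends on `c₀` only. -/
theorem freeProfile_doubling (h : WalkClass c₀ σ2 p) (hc : 0 < c₀) (hc' : c₀ ≤ 1)
    (hσ : 0 < σ2) (hσ' : σ2 ≤ 1 / 2) {L m : ℕ} (hLm : L ≤ 2 * m) :
    freeProfile p m 0 ≤ 1520 / c₀ * freeProfile p L 0 := by
  have hp := h.isSymmStep
  have h1 := h.sqrt_mul_freeProfile_le hc hc' hσ m
  have h2 := h.one_le_mul_freeProfile hσ hσ' L
  have hz := hp.freeProfile_nonneg m 0
  have hzL := hp.freeProfile_nonneg L 0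
  set y := Real.sqrt (σ2 * m)
  set w := Real.sqrt (σ2 * L)
  have hwy : w ≤ 2 * y := by
    refine Real.sqrt_le_iff.2 ⟨by positivity, ?_⟩
    rw [mul_pow, Real.sq_sqrt (by positivity)]
    have : (L : ℝ) ≤ 2 * m := by exact_mod_cast hLm
    nlinarith [Nat.cast_nonneg (α := ℝ) m]
  have h3 : 1 ≤ 1 / c₀ := by rw [le_div_iff₀ hc]; linarith
  have h4 : (1 + y) * freeProfile p m 0 ≤ 19 / c₀ := by
    have := hp.freeProfile_le_one m
    have e : 19 / c₀ = 18 / c₀ + 1 / c₀ := by ring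
    linarith
  have h5 : 1 ≤ 80 * (1 + y) * freeProfile p L 0 :=
    h2.trans (mul_le_mul_of_nonneg_right (by linarith) hzL)
  calc freeProfile p m 0 ≤ freeProfile p m 0 * (80 * (1 + y) * freeProfile p L 0) :=
        le_mul_of_one_le_right hz h5
    _ = 80 * ((1 + y) * freeProfile p m 0) * freeProfile p L 0 := by ring
    _ ≤ 80 * (19 / c₀) * freeProfile p L 0 :=
        mul_le_mul_of_nonneg_right (by linarith) hzL
    _ = _ := by ring

end WalkClass

/-! ### A renewal inequality -/

theorem sum_convolution_le {a b : ℕ → ℝ} (ha : ∀ n, 0 ≤ a n) (hb : ∀ n, 0 ≤ b n) (N : ℕ) :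
    ∑ n ∈ Finset.range N, ∑ i ∈ Finset.range (n + 1), a i * b (n - i) ≤
      (∑ i ∈ Finset.range N, a i) * ∑ i ∈ Finset.range N, b i := by
  rw [Finset.sum_range_diag_flip N fun i k => a i * b k, Finset.sum_mul]
  refine Finset.sum_le_sum fun i _ => ?_
  rw [← Finset.mul_sum]
  refine mul_le_mul_of_nonneg_left ?_ (ha i)
  exact Finset.sum_le_sum_of_subset_of_nonneg (Finset.range_mono (Nat.sub_le _ _))
    fun k _ _ => hb k

/-- If `b` solves a renewal equation whose kernel `η a` has small mass and `a` is dominated by a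
doubling sequence `z`, then `b ≤ 2 z`: in a product `a i * b (n - i)` one of the two times is at
least half of the total, and doubling compares the corresponding factor with `z (n + 1)`. -/
theorem renewal_le_two_mul {a b z : ℕ → ℝ} {η G D : ℝ} (ha : ∀ n, 0 ≤ a n) (hb : ∀ n, 0 ≤ b n)
    (hη : 0 ≤ η) (hD : 1 ≤ D) (haz : ∀ n, a n ≤ z n) (hb0 : b 0 = a 0)
    (hbs : ∀ n, b (n + 1) = a (n + 1) + η * ∑ i ∈ Finset.range (n + 1), a i * b (n - i))
    (hG : ∀ n, ∑ i ∈ Finset.range n, a i ≤ G)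
    (hz : ∀ m n, n + 1 ≤ 2 * (m + 1) → z m ≤ D * z n) (hsmall : 4 * η * D * G ≤ 1) (n : ℕ) :
    b n ≤ 2 * z n := by
  have hG0 : 0 ≤ G := by simpa using hG 0
  have hz0 : ∀ n, 0 ≤ z n := fun n => (ha n).trans (haz n)
  have hηG : η * G ≤ 1 / 4 := by nlinarith [mul_nonneg hη hG0]
  have hB : ∀ N, ∑ i ∈ Finset.range N, b i ≤ 2 * G := by
    intro N
    induction N with
    | zero => simpa using hG0
    | succ N ih =>
      have h1 : ∑ i ∈ Finset.range (N + 1), b i = ∑ i ∈ Finset.range (N + 1), a i +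
          η * ∑ n ∈ Finset.range N, ∑ i ∈ Finset.range (n + 1), a i * b (n - i) := by
        rw [Finset.sum_range_succ', Finset.sum_range_succ' (fun i => a i), hb0, Finset.mul_sum]
        simp only [hbs, Finset.sum_add_distrib]
        ring
      have h2 := (sum_convolution_le ha hb N).trans
        (mul_le_mul (hG N) ih (Finset.sum_nonneg fun i _ => hb i) hG0)
      rw [h1]
      nlinarith [hG (N + 1), mul_le_mul_of_nonneg_left h2 hη]
  induction n using Nat.strong_induction_on with
  | _ n ih =>
    rcases n with _ | n
    · rw [hb0]; linarith [haz 0, hz0 0]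
    have hterm : ∀ i ∈ Finset.range (n + 1), a i * b (n - i) ≤
        D * z (n + 1) * (2 * a i + b (n - i)) := by
      intro i hi
      have hi' := Finset.mem_range.1 hi
      have hDz : 0 ≤ D * z (n + 1) := mul_nonneg (by linarith) (hz0 _)
      rcases le_or_gt (n + 1 + 1) (2 * (n - i + 1)) with h | h
      · have h1 : b (n - i) ≤ 2 * (D * z (n + 1)) :=
          (ih (n - i) (by omega)).trans (by linarith [hz (n - i) (n + 1) h])
        nlinarith [mul_le_mul_of_nonneg_left h1 (ha i), mul_nonneg hDz (hb (n - i))]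
      · have h1 : a i ≤ D * z (n + 1) := (haz i).trans (hz i (n + 1) (by omega))
        nlinarith [mul_le_mul_of_nonneg_right h1 (hb (n - i)), mul_nonneg hDz (ha i)]
    have hsum := Finset.sum_le_sum hterm
    rw [← Finset.mul_sum, Finset.sum_add_distrib, ← Finset.mul_sum,
      Finset.sum_flip (fun i => b i)] at hsum
    have h2 : 2 * ∑ i ∈ Finset.range (n + 1), a i + ∑ i ∈ Finset.range (n + 1), b i ≤ 4 * G := by
      linarith [hG (n + 1), hB (n + 1)]
    have h3 : η * ∑ i ∈ Finset.range (n + 1), a i * b (n - i) ≤ z (n + 1) := by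
      calc _ ≤ η * (D * z (n + 1) * (4 * G)) := mul_le_mul_of_nonneg_left
            (hsum.trans (mul_le_mul_of_nonneg_left h2 (mul_nonneg (by linarith) (hz0 _)))) hη
        _ = (4 * η * D * G) * z (n + 1) := by ring
        _ ≤ _ := mul_le_of_le_one_left (hz0 _) hsmall
    rw [hbs]
    linarith [haz (n + 1)]

/-! ### The weakly pinned walk -/

theorem siteOp_eq (j : ℕ) (ε : ℝ) (u : SeqL2) :
    siteOp j ε u = siteOp j 0 u + ((Real.exp ε - 1) * u 0) • delta := by
  ext x
  simp only [siteOp_apply, lp.coeFn_add, lp.coeFn_smul, Pi.add_apply, Pi.smul_apply, smul_eq_mul,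
    delta_apply, siteWeight, Real.exp_zero]
  by_cases hx : x = 0
  · subst hx
    have hj : ¬(0 : ℤ) < -(j : ℤ) := by omega
    simp only [hj, ↓reduceIte]
    ring
  · simp [hx]

theorem siteOp_delta (j : ℕ) (ε : ℝ) : siteOp j ε delta = Real.exp ε • delta := by
  ext x
  simp only [siteOp_apply, lp.coeFn_smul, Pi.smul_apply, smul_eq_mul, delta_apply]
  split_ifs with h
  · subst h; rw [siteWeight_zero]
  · simp

theorem siteOp_zero_idem (j : ℕ) (u : SeqL2) : siteOp j 0 (siteOp j 0 u) = siteOp j 0 u := by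
  ext x
  simp only [siteOp_apply, siteWeight, Real.exp_zero]
  split_ifs <;> simp

namespace IsSymmStep

variable {p : ℤ → ℝ}

theorem pinnedProfile_zero_le (hp : IsSymmStep p) (j n : ℕ) (x : ℤ) :
    pinnedProfile p j 0 n x ≤ freeProfile p n x := by
  induction n generalizing x with
  | zero => exact le_rfl
  | succ n ih =>
    rw [pinnedProfile_succ, freeProfile_succ]
    refine hp.walkOp_mono (fun y => ?_) x
    refine le_trans ?_ (ih y)
    refine mul_le_of_le_one_left (hp.pinnedProfile_nonneg j 0 n y) ?_
    unfold siteWeight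
    split_ifs <;> simp

/-- The Green function at the origin of the walk killed below `-j` is at most `(j + 1) / p 1`:
the Green function vanishes at `-j - 1` and its energy is at most its value at the origin. -/
theorem sum_pinnedProfile_zero_le (hp : IsSymmStep p) (h1 : 0 < p 1) (j n : ℕ) :
    ∑ i ∈ Finset.range n, pinnedProfile p j 0 i 0 ≤ (j + 1) / p 1 := by
  have hE := hp.green_energy_le (siteOp j 0) (inner_mulOp _) (siteOp_zero_idem j)
    (by simp [siteOp_delta]) (t := pinnedProfile p j 0) rfl (pinnedProfile_succ p j 0)
    (fun i x => mul_nonneg (siteWeight_nonneg _ _ _) (hp.pinnedProfile_nonneg j 0 i x)) n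
  set g : SeqL2 := ∑ i ∈ Finset.range n, siteOp j 0 (pinnedProfile p j 0 i) with hg
  have hgx : ∀ x, g x = ∑ i ∈ Finset.range n, siteOp j 0 (pinnedProfile p j 0 i) x := fun x => by
    rw [hg, lp.coeFn_sum, Finset.sum_apply]
  have hg0 : g 0 = ∑ i ∈ Finset.range n, pinnedProfile p j 0 i 0 := by
    simp [hgx, siteWeight_zero]
  rw [← hgx] at hE
  rw [← hg0]
  have hbd : g (-((j + 1 : ℕ) : ℤ)) = 0 := by
    rw [hgx]
    refine Finset.sum_eq_zero fun i _ => ?_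
    rw [siteOp_apply, siteWeight_eq_zero (by push_cast; omega), zero_mul]
  have hd := sub_sq_le g (-((j + 1 : ℕ) : ℤ)) (j + 1)
  rw [hbd, neg_add_cancel, sub_zero] at hd
  rw [le_div_iff₀ h1]
  have hnn : 0 ≤ g 0 := by
    rw [hg0]; exact Finset.sum_nonneg fun i _ => hp.pinnedProfile_nonneg j 0 i 0
  rcases hnn.eq_or_lt with h0 | h0
  · rw [← h0, zero_mul]; positivity
  refine le_of_mul_le_mul_left ?_ h0
  push_cast at hd
  nlinarith [mul_le_mul_of_nonneg_left hE (by positivity : (0 : ℝ) ≤ (j : ℝ) + 1)]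

theorem pinnedProfile_one (p : ℤ → ℝ) (j : ℕ) (ε : ℝ) :
    pinnedProfile p j ε 1 = Real.exp ε • walkOp p delta := by
  rw [pinnedProfile_succ]
  change walkOp p (siteOp j ε delta) = _
  rw [siteOp_delta, map_smul]

/-- The renewal equation of the pinned walk: decompose at the first rewarded contact. -/
theorem pinnedProfile_renewal (p : ℤ → ℝ) (j : ℕ) (ε : ℝ) (n : ℕ) :
    Real.exp (-ε) • pinnedProfile p j ε (n + 1) = pinnedProfile p j 0 (n + 1) +
      (Real.exp ε - 1) • ∑ i ∈ Finset.range n,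
        (Real.exp (-ε) * pinnedProfile p j ε (n - 1 - i + 1) 0) •
          pinnedProfile p j 0 (i + 1) := by
  induction n with
  | zero =>
    simp only [zero_add, pinnedProfile_one, smul_smul, ← Real.exp_add]
    simp
  | succ n ih =>
    have hstep : Real.exp (-ε) • pinnedProfile p j ε (n + 1 + 1) =
        walkOp p (siteOp j 0 (Real.exp (-ε) • pinnedProfile p j ε (n + 1))) +
          ((Real.exp ε - 1) * (Real.exp (-ε) * pinnedProfile p j ε (n + 1) 0)) •
            pinnedProfile p j 0 1 := by
      rw [pinnedProfile_succ, siteOp_eq, pinnedProfile_one]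
      simp only [map_add, map_smul, smul_add, smul_smul, Real.exp_zero, mul_one]
      congr 2
      ring
    rw [hstep, ih]
    simp only [map_add, map_smul, map_sum, ← pinnedProfile_succ]
    rw [Finset.sum_range_succ', smul_add, smul_smul, ← add_assoc]
    have hidx : ∀ i, n - 1 - i = n - (i + 1) := fun i => by omega
    simp only [hidx, zero_add, Nat.sub_zero, Nat.add_sub_cancel]

end IsSymmStep

/-- Below the critical reward the pinned partition function is at most twice the free one. The
constant `24320 = 16 * 1520` makes the product of `4 (exp ε - 1)`, the doubling constant
`1520 / c₀` and the bound `2 (j + 1) / (c₀ σ²)` on the Green function at most `1`. -/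
theorem WalkClass.pinned_le_two_mul {c₀ σ2 : ℝ} {p : ℤ → ℝ} (h : WalkClass c₀ σ2 p)
    (hc : 0 < c₀) (hc' : c₀ ≤ 1) (hσ : 0 < σ2) (hσ' : σ2 ≤ 1 / 2) (j : ℕ) {ε : ℝ}
    (hε : ε ≤ c₀ ^ 2 / 24320 * σ2 / (j + 1)) (n : ℕ) :
    Real.exp (-ε) * pinnedProfile p j ε (n + 1) 0 ≤ 2 * freeProfile p (n + 1) 0 := by
  have hp := h.isSymmStep
  refine (hp.pinned_mono j n hε).trans ?_
  set e := c₀ ^ 2 / 24320 * σ2 / ((j : ℝ) + 1) with he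
  have hj : (0 : ℝ) < (j : ℝ) + 1 := by positivity
  have he0 : 0 ≤ e := by positivity
  have hej : e * (j + 1) = c₀ ^ 2 / 24320 * σ2 := by rw [he]; field_simp
  have he1 : e ≤ 1 := by
    have : c₀ ^ 2 / 24320 * σ2 ≤ 1 := by nlinarith
    nlinarith [Nat.cast_nonneg (α := ℝ) j]
  have hη0 : 0 ≤ Real.exp e - 1 := by linarith [Real.one_le_exp he0]
  have hη : Real.exp e - 1 ≤ 2 * e := by
    have := Real.abs_exp_sub_one_le (x := e) (by rwa [abs_of_nonneg he0])
    rwa [abs_of_nonneg hη0, abs_of_nonneg he0] at this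
  have hp1 : c₀ * σ2 / 2 ≤ p 1 := h.one_step
  have hq : 0 < c₀ * σ2 / 2 := by positivity
  have hG : ((j : ℝ) + 1) / p 1 ≤ (j + 1) / (c₀ * σ2 / 2) :=
    div_le_div_of_nonneg_left hj.le hq hp1
  refine renewal_le_two_mul (a := fun n => pinnedProfile p j 0 (n + 1) 0)
    (b := fun n => Real.exp (-e) * pinnedProfile p j e (n + 1) 0)
    (z := fun n => freeProfile p (n + 1) 0) (η := Real.exp e - 1)
    (G := (j + 1) / (c₀ * σ2 / 2)) (D := 1520 / c₀)
    (fun n => hp.pinnedProfile_nonneg _ _ _ _)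
    (fun n => mul_nonneg (Real.exp_nonneg _) (hp.pinnedProfile_nonneg _ _ _ _)) hη0 ?_
    (fun n => hp.pinnedProfile_zero_le j _ 0) ?_ (fun n => ?_) (fun n => ?_)
    (fun m n hmn => h.freeProfile_doubling hc hc' hσ hσ' hmn) ?_ n
  · rw [le_div_iff₀ hc]; linarith
  · simpa using congrArg (fun u : SeqL2 => u 0) (IsSymmStep.pinnedProfile_renewal p j e 0)
  · have := congrArg (fun u : SeqL2 => u 0) (IsSymmStep.pinnedProfile_renewal p j e (n + 1))
    simp only [lp.coeFn_add, lp.coeFn_smul, lp.coeFn_sum, Pi.add_apply, Pi.smul_apply,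
      Finset.sum_apply, smul_eq_mul, Nat.add_sub_cancel] at this
    rw [this]
    congr 2
    exact Finset.sum_congr rfl fun i _ => mul_comm _ _
  · refine le_trans ?_ ((hp.sum_pinnedProfile_zero_le (hq.trans_le hp1) j (n + 1)).trans hG)
    rw [Finset.sum_range_succ']
    exact le_add_of_nonneg_right (hp.pinnedProfile_nonneg _ _ _ _)
  · calc 4 * (Real.exp e - 1) * (1520 / c₀) * ((j + 1) / (c₀ * σ2 / 2))
        ≤ 4 * (2 * e) * (1520 / c₀) * ((j + 1) / (c₀ * σ2 / 2)) := by gcongr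
      _ = 24320 * (e * (j + 1)) / (c₀ ^ 2 * σ2) := by field_simp; ring
      _ = 1 := by rw [hej]; field_simp
      _ ≤ 1 := le_rfl

/-! ### The strongly pinned walk -/

theorem siteWeight_mul (j : ℕ) (ε ε' : ℝ) (x : ℤ) :
    siteWeight j ε x * siteWeight j ε' x = siteWeight j (ε + ε') x := by
  unfold siteWeight
  split_ifs <;> simp [Real.exp_add]

theorem siteWeight_pos {j : ℕ} {ε : ℝ} {x : ℤ} (hx : -(j : ℤ) ≤ x) : 0 < siteWeight j ε x := by
  rw [siteWeight_of_le hx]; split_ifs <;> positivity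

theorem siteOp_siteOp (j : ℕ) (ε ε' : ℝ) (u : SeqL2) :
    siteOp j ε (siteOp j ε' u) = siteOp j (ε + ε') u := by
  ext x; simp [← mul_assoc, siteWeight_mul]

/-- The symmetrized transfer operator of the pinned walk: the weight of a site is split evenly
between the step that enters it and the step that leaves it. -/
noncomputable def transferOp (p : ℤ → ℝ) (j : ℕ) (ε : ℝ) : SeqL2 →L[ℝ] SeqL2 :=
  siteOp j (ε / 2) ∘L walkOp p ∘L siteOp j (ε / 2)

theorem transferOp_apply (p : ℤ → ℝ) (j : ℕ) (ε : ℝ) (u : SeqL2) :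
    transferOp p j ε u = siteOp j (ε / 2) (walkOp p (siteOp j (ε / 2) u)) := rfl

theorem siteOp_pinnedProfile (p : ℤ → ℝ) (j : ℕ) (ε : ℝ) (n : ℕ) :
    siteOp j (ε / 2) (pinnedProfile p j ε n) =
      Real.exp (ε / 2) • (transferOp p j ε)^[n] delta := by
  induction n with
  | zero => exact siteOp_delta j (ε / 2)
  | succ n ih =>
    rw [pinnedProfile_succ, Function.iterate_succ_apply', ← map_smul, ← ih, transferOp_apply,
      siteOp_siteOp j (ε / 2) (ε / 2), add_halves]

theorem pinnedProfile_eq_transferOp (p : ℤ → ℝ) (j : ℕ) (ε : ℝ) (n : ℕ) :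
    pinnedProfile p j ε n 0 = (transferOp p j ε)^[n] delta 0 := by
  have h := congrArg (fun u : SeqL2 => u 0) (siteOp_pinnedProfile p j ε n)
  simp only [siteOp_apply, siteWeight_zero, lp.coeFn_smul, Pi.smul_apply, smul_eq_mul] at h
  exact mul_left_cancel₀ (Real.exp_ne_zero _) h

/-- The norms of the iterates of a symmetric operator are log-convex, so they grow at least at
the rate of the Rayleigh quotient. -/
theorem pow_mul_norm_le_iterate {E : Type*} [NormedAddCommGroup E] [InnerProductSpace ℝ E]
    {T : E → E} (hT : ∀ u v, inner ℝ (T u) v = inner ℝ u (T v)) {φ : E} {r : ℝ} (hr : 0 ≤ r)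
    (hφ : r * ‖φ‖ ^ 2 ≤ inner ℝ φ (T φ)) (n : ℕ) : r ^ n * ‖φ‖ ≤ ‖T^[n] φ‖ := by
  have hstep : ∀ n, r * ‖T^[n] φ‖ ≤ ‖T^[n + 1] φ‖ := by
    intro n
    induction n with
    | zero =>
      have h1 : r * ‖φ‖ ^ 2 ≤ ‖φ‖ * ‖T φ‖ := hφ.trans (real_inner_le_norm _ _)
      rcases (norm_nonneg φ).eq_or_lt with h0 | h0
      · simp [← h0]
      · refine le_of_mul_le_mul_left ?_ h0
        simp only [Function.iterate_zero, id, zero_add, Function.iterate_one]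
        linarith
    | succ n ih =>
      rcases (norm_nonneg (T^[n + 1] φ)).eq_or_lt with h0 | h0
      · rw [← h0, mul_zero]; exact norm_nonneg _
      · refine le_of_mul_le_mul_left ?_ h0
        have h1 : ‖T^[n + 1] φ‖ ^ 2 ≤ ‖T^[n] φ‖ * ‖T^[n + 1 + 1] φ‖ := by
          rw [← real_inner_self_eq_norm_sq]
          nth_rewrite 1 [Function.iterate_succ_apply']
          rw [hT, ← Function.iterate_succ_apply' T (n + 1)]
          exact real_inner_le_norm _ _
        nlinarith [mul_le_mul_of_nonneg_left h1 hr,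
          mul_le_mul_of_nonneg_right ih (norm_nonneg (T^[n + 1 + 1] φ))]
  induction n with
  | zero => simp
  | succ n ih =>
    calc r ^ (n + 1) * ‖φ‖ = r * (r ^ n * ‖φ‖) := by ring
      _ ≤ r * ‖T^[n] φ‖ := mul_le_mul_of_nonneg_left ih hr
      _ ≤ _ := hstep n

/-- The tent `(j + 1 - |x|)⁺`. -/
noncomputable def tent (j : ℕ) : SeqL2 :=
  ⟨fun x => ((max 0 ((j : ℤ) + 1 - |x|) : ℤ) : ℝ),
    memℓp_two_of_support (Finset.Icc (-(j : ℤ)) j) fun x hx => by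
      rw [Finset.mem_Icc, ← abs_le, not_le] at hx
      rw [max_eq_left (by omega), Int.cast_zero]⟩

theorem tent_apply (j : ℕ) (x : ℤ) :
    tent j x = ((max 0 ((j : ℤ) + 1 - |x|) : ℤ) : ℝ) := rfl

theorem tent_eq_zero {j : ℕ} {x : ℤ} (hx : x ∉ Finset.Icc (-(j : ℤ)) j) : tent j x = 0 := by
  rw [Finset.mem_Icc, ← abs_le, not_le] at hx
  rw [tent_apply, max_eq_left (by omega), Int.cast_zero]

theorem tent_nonneg (j : ℕ) (x : ℤ) : 0 ≤ tent j x := by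
  rw [tent_apply]; exact Int.cast_nonneg (le_max_left _ _)

theorem tent_zero (j : ℕ) : tent j 0 = j + 1 := by
  rw [tent_apply, abs_zero, sub_zero, max_eq_right (by omega)]; simp

theorem norm_tent_sq_le (j : ℕ) : ‖tent j‖ ^ 2 ≤ 2 * ((j : ℝ) + 1) ^ 3 := by
  rw [← real_inner_self_eq_norm_sq, inner_eq_sum fun x hx => tent_eq_zero hx]
  calc _ ≤ ∑ _x ∈ Finset.Icc (-(j : ℤ)) j, ((j : ℝ) + 1) ^ 2 :=
        Finset.sum_le_sum fun x _ => by
          have h1 : tent j x ≤ j + 1 := by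
            rw [tent_apply]
            have : max 0 ((j : ℤ) + 1 - |x|) ≤ j + 1 := by
              have := abs_nonneg x; omega
            have h2 : ((max 0 ((j : ℤ) + 1 - |x|) : ℤ) : ℝ) ≤ (((j : ℤ) + 1 : ℤ) : ℝ) :=
              Int.cast_le.2 this
            simpa only [Int.cast_add, Int.cast_natCast, Int.cast_one] using h2
          nlinarith [tent_nonneg j x]
    _ = (2 * j + 1) * ((j : ℝ) + 1) ^ 2 := by
        rw [Finset.sum_const, Int.card_Icc, nsmul_eq_mul]
        have : ((j : ℤ) + 1 - -(j : ℤ)).toNat = 2 * j + 1 := by omega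
        rw [this]; push_cast; ring
    _ ≤ _ := by nlinarith [sq_nonneg ((j : ℝ) + 1)]

theorem norm_shift_tent_sub_sq_le (j : ℕ) :
    ‖shift 1 (tent j) - tent j‖ ^ 2 ≤ 2 * ((j : ℝ) + 1) := by
  have hsupp : ∀ x ∉ Finset.Icc (-(j : ℤ)) (j + 1), (shift 1 (tent j) - tent j) x = 0 := by
    intro x hx
    rw [Finset.mem_Icc] at hx
    rw [lp.coeFn_sub, Pi.sub_apply, shift_apply, tent_eq_zero, tent_eq_zero, sub_zero] <;>
    · rw [Finset.mem_Icc]; omega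
  rw [← real_inner_self_eq_norm_sq, inner_eq_sum hsupp]
  calc _ ≤ ∑ _x ∈ Finset.Icc (-(j : ℤ)) (j + 1), (1 : ℝ) :=
        Finset.sum_le_sum fun x _ => by
          rw [lp.coeFn_sub, Pi.sub_apply, shift_apply, ← sq, tent_apply, tent_apply,
            ← Int.cast_sub, sq_le_one_iff_abs_le_one, ← Int.cast_abs]
          have : |max 0 ((j : ℤ) + 1 - |x - 1|) - max 0 ((j : ℤ) + 1 - |x|)| ≤ 1 := by
            have h1 := abs_abs_sub_abs_le (x - 1) x
            grind
          exact_mod_cast this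
    _ = _ := by
        rw [Finset.sum_const, Int.card_Icc, nsmul_eq_mul]
        have : ((j : ℤ) + 1 + 1 - -(j : ℤ)).toNat = 2 * j + 2 := by omega
        rw [this]; push_cast; ring

namespace IsSymmStep

variable {p : ℤ → ℝ}

theorem inner_transferOp (hp : IsSymmStep p) (j : ℕ) (ε : ℝ) (u v : SeqL2) :
    inner ℝ (transferOp p j ε u) v = inner ℝ u (transferOp p j ε v) := by
  simp only [transferOp_apply, siteOp, inner_mulOp, hp.inner_walkOp]

theorem transferOp_mono (hp : IsSymmStep p) (j : ℕ) (ε : ℝ) {u v : SeqL2}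
    (h : ∀ x, u x ≤ v x) (x : ℤ) : transferOp p j ε u x ≤ transferOp p j ε v x :=
  mul_le_mul_of_nonneg_left (hp.walkOp_mono (fun y =>
    mul_le_mul_of_nonneg_left (h y) (siteWeight_nonneg _ _ _)) x) (siteWeight_nonneg _ _ _)

theorem iterate_transferOp_mono (hp : IsSymmStep p) (j : ℕ) (ε : ℝ) {u v : SeqL2}
    (h : ∀ x, u x ≤ v x) (n : ℕ) (x : ℤ) :
    (transferOp p j ε)^[n] u x ≤ (transferOp p j ε)^[n] v x := by
  induction n generalizing x with
  | zero => exact h x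
  | succ n ih =>
    rw [Function.iterate_succ_apply', Function.iterate_succ_apply']
    exact hp.transferOp_mono j ε ih x

theorem iterate_transferOp_nonneg (hp : IsSymmStep p) (j : ℕ) (ε : ℝ) {u : SeqL2}
    (h : ∀ x, 0 ≤ u x) (n : ℕ) (x : ℤ) : 0 ≤ (transferOp p j ε)^[n] u x := by
  have h1 := hp.iterate_transferOp_mono j ε (u := 0) (v := u) h n x
  have h2 : (transferOp p j ε)^[n] 0 = 0 := Function.iterate_fixed (map_zero _) n
  rwa [h2] at h1

theorem inner_iterate_transferOp (hp : IsSymmStep p) (j : ℕ) (ε : ℝ) (n : ℕ) (u v : SeqL2) :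
    inner ℝ ((transferOp p j ε)^[n] u) v = inner ℝ u ((transferOp p j ε)^[n] v) := by
  induction n generalizing v with
  | zero => rfl
  | succ n ih =>
    rw [Function.iterate_succ_apply', hp.inner_transferOp, ih, Function.iterate_succ_apply]

/-- After `n` steps the pinned walk reaches every allowed site within distance `n`. -/
theorem iterate_transferOp_delta_pos (hp : IsSymmStep p) (h0 : 0 < p 0) (h1 : 0 < p 1) (j : ℕ)
    (ε : ℝ) (n : ℕ) {x : ℤ} (hx : |x| ≤ n) (hxj : -(j : ℤ) ≤ x) :
    0 < (transferOp p j ε)^[n] delta x := by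
  induction n generalizing x with
  | zero =>
    have : x = 0 := by simpa using hx
    subst this
    simp [delta_apply]
  | succ n ih =>
    set u := (transferOp p j ε)^[n] delta with hu
    have hu0 : ∀ y, 0 ≤ u y := hp.iterate_transferOp_nonneg j ε delta_nonneg n
    obtain ⟨y, hy, hyj, hpy⟩ : ∃ y : ℤ, |y| ≤ n ∧ -(j : ℤ) ≤ y ∧ 0 < p (x - y) := by
      push_cast at hx
      rcases le_or_gt |x| (n : ℤ) with h | h
      · exact ⟨x, h, hxj, by simpa using h0⟩
      · rcases le_total 0 x with h2 | h2
        · rw [abs_of_nonneg h2] at h hx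
          exact ⟨x - 1, by rw [abs_le]; omega, by omega, by simpa using h1⟩
        · rw [abs_of_nonpos h2] at h hx
          refine ⟨x + 1, by rw [abs_le]; omega, by omega, ?_⟩
          have : x - (x + 1) = -1 := by ring
          rw [this, hp.symm]
          exact h1
    rw [Function.iterate_succ_apply', ← hu, transferOp_apply, siteOp_apply]
    refine mul_pos (siteWeight_pos hxj) (lt_of_lt_of_le ?_ (le_hasSum
      (hp.hasSum_walkOp_apply_sub (siteOp j (ε / 2) u) x) y fun k _ =>
        mul_nonneg (hp.nonneg _) (mul_nonneg (siteWeight_nonneg _ _ _) (hu0 _))))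
    exact mul_pos hpy (mul_pos (siteWeight_pos hyj) (ih hy hyj))

theorem mul_pinnedProfile_le_succ (hp : IsSymmStep p) (j : ℕ) (ε : ℝ) (n : ℕ) :
    p 0 * Real.exp ε * pinnedProfile p j ε n 0 ≤ pinnedProfile p j ε (n + 1) 0 := by
  rw [pinnedProfile_succ]
  have h := le_hasSum (hp.hasSum_walkOp_apply' (siteOp j ε (pinnedProfile p j ε n)) 0) 0
    fun k _ => mul_nonneg (hp.nonneg k)
      (mul_nonneg (siteWeight_nonneg _ _ _) (hp.pinnedProfile_nonneg j ε n _))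
  simpa [siteWeight_zero, mul_assoc] using h

/-- A lower bound on the Rayleigh quotient at a nonnegative vector supported in `[-j, j]` bounds
the growth of the pinned partition function from below. -/
theorem exists_pinnedProfile_lower (hp : IsSymmStep p) (h0 : 0 < p 0) (h1 : 0 < p 1) (j : ℕ)
    (ε : ℝ) {φ : SeqL2} (hφ : ∀ x, 0 ≤ φ x) (hsupp : ∀ x ∉ Finset.Icc (-(j : ℤ)) j, φ x = 0)
    (hφ0 : φ ≠ 0) {μ : ℝ} (hμ : Real.exp μ * ‖φ‖ ^ 2 ≤ inner ℝ φ (transferOp p j ε φ)) :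
    ∃ κ > 0, ∀ᶠ L : ℕ in atTop, κ * Real.exp (μ * L) ≤ pinnedProfile p j ε L 0 := by
  set T := transferOp p j ε
  set ψ := T^[j] delta with hψ
  have hψpos : ∀ x ∈ Finset.Icc (-(j : ℤ)) j, 0 < ψ x := fun x hx => by
    rw [Finset.mem_Icc] at hx
    exact hp.iterate_transferOp_delta_pos h0 h1 j ε j (abs_le.2 hx) hx.1
  have hψ0 : ∀ x, 0 ≤ ψ x := hp.iterate_transferOp_nonneg j ε delta_nonneg j
  set C := 1 + ∑ x ∈ Finset.Icc (-(j : ℤ)) j, φ x / ψ x with hC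
  have hsum0 : 0 ≤ ∑ x ∈ Finset.Icc (-(j : ℤ)) j, φ x / ψ x :=
    Finset.sum_nonneg fun x _ => div_nonneg (hφ x) (hψ0 x)
  have hC0 : 0 < C := by linarith
  have hle : ∀ x, φ x ≤ (C • ψ) x := by
    intro x
    rw [lp.coeFn_smul, Pi.smul_apply, smul_eq_mul]
    by_cases hx : x ∈ Finset.Icc (-(j : ℤ)) j
    · rw [← div_le_iff₀ (hψpos x hx)]
      have := Finset.single_le_sum (f := fun x => φ x / ψ x)
        (fun x _ => div_nonneg (hφ x) (hψ0 x)) hx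
      simp only at this
      linarith
    · rw [hsupp x hx]; exact mul_nonneg hC0.le (hψ0 x)
  have hnφ : 0 < ‖φ‖ := norm_pos_iff.2 hφ0
  -- even times: `‖T ^ n φ‖² ≤ C² ‖T ^ (n + j) δ‖²`, a diagonal entry at time `2 (n + j)`
  have heven : ∀ n, (‖φ‖ / C) ^ 2 * Real.exp (μ * (2 * n : ℕ)) ≤
      pinnedProfile p j ε (2 * (n + j)) 0 := by
    intro n
    have e1 := pow_mul_norm_le_iterate (hp.inner_transferOp j ε) (Real.exp_nonneg μ) hμ n
    have e2 : ‖T^[n] φ‖ ^ 2 ≤ C ^ 2 * ‖T^[n + j] delta‖ ^ 2 := by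
      refine hasSum_le (fun x => ?_) (hasSum_sq _) ((hasSum_sq _).mul_left (C ^ 2))
      rw [← mul_pow]
      refine pow_le_pow_left₀ (hp.iterate_transferOp_nonneg j ε hφ n x) ?_ 2
      refine (hp.iterate_transferOp_mono j ε hle n x).trans_eq ?_
      have : T^[n] (C • ψ) = C • T^[n + j] delta := by
        rw [Function.iterate_add_apply, ← hψ]
        exact Function.Commute.iterate_left (f := T) (g := fun u => C • u) (map_smul T C) n ψ
      rw [this]; rfl
    have e3 : ‖T^[n + j] delta‖ ^ 2 = pinnedProfile p j ε (2 * (n + j)) 0 := by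
      rw [← real_inner_self_eq_norm_sq, hp.inner_iterate_transferOp, inner_delta_left,
        ← Function.iterate_add_apply, ← two_mul, pinnedProfile_eq_transferOp]
    rw [e3] at e2
    have e4 := (pow_le_pow_left₀ (by positivity) e1 2).trans e2
    have e5 : Real.exp (μ * (2 * n : ℕ)) = (Real.exp μ ^ n) ^ 2 := by
      rw [← pow_mul, ← Real.exp_nat_mul]; congr 1; push_cast; ring
    rw [e5, div_pow, div_mul_eq_mul_div, div_le_iff₀ (by positivity)]
    rw [mul_pow] at e4
    linarith
  set q := min (Real.exp (-(μ * (2 * j : ℕ)))) (p 0 * Real.exp ε *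
    Real.exp (-(μ * (2 * j + 1 : ℕ)))) with hq
  refine ⟨(‖φ‖ / C) ^ 2 * q, by positivity, ?_⟩
  filter_upwards [eventually_ge_atTop (2 * j)] with L hL
  rcases Nat.even_or_odd' L with ⟨k, rfl | rfl⟩
  · obtain ⟨n, rfl⟩ := Nat.exists_eq_add_of_le (show j ≤ k by omega)
    rw [add_comm j n]
    refine le_trans ?_ (heven n)
    rw [mul_assoc]
    refine mul_le_mul_of_nonneg_left ?_ (by positivity)
    refine (mul_le_mul_of_nonneg_right (min_le_left _ _) (Real.exp_nonneg _)).trans_eq ?_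
    rw [← Real.exp_add]; congr 1; push_cast; ring
  · obtain ⟨n, rfl⟩ := Nat.exists_eq_add_of_le (show j ≤ k by omega)
    rw [add_comm j n]
    refine le_trans ?_ (hp.mul_pinnedProfile_le_succ j ε _)
    refine le_trans ?_ (mul_le_mul_of_nonneg_left (heven n) (by positivity))
    rw [mul_assoc, mul_left_comm (p 0 * Real.exp ε)]
    refine mul_le_mul_of_nonneg_left ?_ (by positivity)
    refine (mul_le_mul_of_nonneg_right (min_le_right _ _) (Real.exp_nonneg _)).trans_eq ?_
    rw [mul_assoc, ← Real.exp_add]; congr 2; push_cast; ring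

/-- The Rayleigh quotient of the transfer operator at the tent, divided by the square root of the
site weights: the reward at the apex outweighs the Dirichlet energy of the tent. -/
theorem rayleigh_tent (hp : IsSymmStep p) {σ2 : ℝ}
    (hvar : HasSum (fun k : ℤ => (k : ℝ) ^ 2 * p k) σ2) (hσ : 0 < σ2) (hσ' : σ2 ≤ 1 / 2) (j : ℕ)
    {ε : ℝ} (hε : 4 * σ2 / (j + 1) ≤ ε) :
    Real.exp (σ2 / (12 * ((j : ℝ) + 1) ^ 2)) * ‖siteOp j (-(ε / 2)) (tent j)‖ ^ 2 ≤
      inner ℝ (siteOp j (-(ε / 2)) (tent j))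
        (transferOp p j ε (siteOp j (-(ε / 2)) (tent j))) := by
  have htent : siteOp j 0 (tent j) = tent j := by
    ext x
    by_cases hx : x ∈ Finset.Icc (-(j : ℤ)) j
    · rw [siteOp_apply, siteWeight_of_le (Finset.mem_Icc.1 hx).1]; simp
    · rw [siteOp_apply, tent_eq_zero hx, mul_zero]
  have hinner : inner ℝ (siteOp j (-(ε / 2)) (tent j))
      (transferOp p j ε (siteOp j (-(ε / 2)) (tent j))) =
        inner ℝ (tent j) (walkOp p (tent j)) := by
    rw [transferOp_apply, siteOp_siteOp, add_neg_cancel, htent]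
    rw [siteOp, inner_mulOp]
    change inner ℝ _ (siteOp j (-(ε / 2)) (siteOp j (ε / 2) _)) = _
    rw [siteOp_siteOp, neg_add_cancel]
    change inner ℝ _ (mulOp _ _ _ _) = _
    rw [← inner_mulOp]
    change inner ℝ (siteOp j 0 _) _ = _
    rw [htent]
  have hnorm : ‖siteOp j (-(ε / 2)) (tent j)‖ ^ 2 =
      ‖tent j‖ ^ 2 - (1 - Real.exp (-ε)) * ((j : ℝ) + 1) ^ 2 := by
    rw [← real_inner_self_eq_norm_sq, siteOp, inner_mulOp]
    change inner ℝ _ (siteOp j (-(ε / 2)) (siteOp j (-(ε / 2)) _)) = _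
    rw [siteOp_siteOp, ← neg_add, add_halves, siteOp_eq, htent, inner_add_right,
      real_inner_self_eq_norm_sq, inner_smul_right, inner_delta_right, tent_zero]
    ring
  rw [hinner, hnorm]
  have hE := hp.energy_upper hvar (tent j)
  have hF := norm_tent_sq_le j
  have hD := norm_shift_tent_sub_sq_le j
  set F := ‖tent j‖ ^ 2
  set h : ℝ := (j : ℝ) + 1 with hh
  have h1 : 1 ≤ h := by rw [hh]; linarith [Nat.cast_nonneg (α := ℝ) j]
  have h0 : 0 < h := by linarith
  set t := 4 * σ2 / h with ht
  have hth : t * h = 4 * σ2 := by rw [ht]; field_simp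
  have ht0 : 0 < t := by positivity
  have ht2 : t ≤ 2 := by rw [ht, div_le_iff₀ h0]; linarith
  have hexp : t / 3 ≤ 1 - Real.exp (-ε) := by
    have e1 : Real.exp (-ε) ≤ (1 + t)⁻¹ := by
      rw [Real.exp_neg]
      exact inv_anti₀ (by linarith) ((by linarith [Real.add_one_le_exp t] :
        1 + t ≤ Real.exp t).trans (Real.exp_le_exp.2 hε))
    have e2 : (1 + t)⁻¹ ≤ 1 - t / 3 := by
      rw [inv_le_iff_one_le_mul₀ (by linarith)]
      nlinarith
    linarith
  have hgain : 4 / 3 * σ2 * h ≤ (1 - Real.exp (-ε)) * h ^ 2 := by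
    calc 4 / 3 * σ2 * h = t / 3 * h ^ 2 := by linear_combination (-h / 3) * hth
      _ ≤ _ := mul_le_mul_of_nonneg_right hexp (by positivity)
  have hloss : F - σ2 * h ≤ inner ℝ (tent j) (walkOp p (tent j)) := by
    have := mul_le_mul_of_nonneg_left hD (by positivity : 0 ≤ σ2 / 2)
    linarith
  have hnn : 0 ≤ F - (1 - Real.exp (-ε)) * h ^ 2 := by rw [← hnorm]; positivity
  set y := σ2 / (12 * h ^ 2) with hy
  have hy0 : 0 ≤ y := by positivity
  have hyh : y * h ^ 2 = σ2 / 12 := by rw [hy]; field_simp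
  have hy1 : y ≤ 1 := by rw [hy, div_le_one (by positivity)]; nlinarith
  have hexpy : Real.exp y ≤ 1 + 2 * y := by
    have := Real.abs_exp_sub_one_le (x := y) (by rwa [abs_of_nonneg hy0])
    rw [abs_of_nonneg hy0] at this
    linarith [le_abs_self (Real.exp y - 1)]
  calc Real.exp y * (F - (1 - Real.exp (-ε)) * h ^ 2)
      ≤ (1 + 2 * y) * (F - (1 - Real.exp (-ε)) * h ^ 2) := mul_le_mul_of_nonneg_right hexpy hnn
    _ ≤ (1 + 2 * y) * (F - 4 / 3 * σ2 * h) :=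
        mul_le_mul_of_nonneg_left (by linarith) (by positivity)
    _ ≤ F - 4 / 3 * σ2 * h + 2 * y * (2 * h ^ 3) := by
        have : 2 * y * (F - 4 / 3 * σ2 * h) ≤ 2 * y * (2 * h ^ 3) :=
          mul_le_mul_of_nonneg_left (by linarith [mul_pos hσ h0]) (by positivity)
        linarith
    _ = F - σ2 * h := by linear_combination (4 * h) * hyh
    _ ≤ _ := hloss

end IsSymmStep

/-- Above the critical reward the pinned partition function grows exponentially. -/
theorem WalkClass.eventually_exp_le_pinned {c₀ σ2 : ℝ} {p : ℤ → ℝ} (h : WalkClass c₀ σ2 p)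
    (hc : 0 < c₀) (hσ : 0 < σ2) (hσ' : σ2 ≤ 1 / 2) (j : ℕ) {ε : ℝ}
    (hε : 4 * σ2 / (j + 1) ≤ ε) :
    ∀ᶠ L : ℕ in atTop, Real.exp (1 / 24 * σ2 * L / ((j : ℝ) + 1) ^ 2) ≤
      Real.exp (-ε) * pinnedProfile p j ε L 0 := by
  have hp := h.isSymmStep
  have h0 : 0 < p 0 := by linarith [h.one_sub_le]
  have h1 : 0 < p 1 := lt_of_lt_of_le (by positivity) h.one_step
  set φ := siteOp j (-(ε / 2)) (tent j) with hφ
  have hφ0 : φ ≠ 0 := by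
    intro hcon
    have : φ 0 = 0 := by rw [hcon]; rfl
    rw [hφ, siteOp_apply, siteWeight_zero, tent_zero] at this
    have : 0 < Real.exp (-(ε / 2)) * ((j : ℝ) + 1) := by positivity
    linarith
  obtain ⟨κ, hκ, hev⟩ := hp.exists_pinnedProfile_lower h0 h1 j ε (φ := φ)
    (fun x => mul_nonneg (siteWeight_nonneg _ _ _) (tent_nonneg j x))
    (fun x hx => by rw [hφ, siteOp_apply, tent_eq_zero hx, mul_zero]) hφ0
    (hp.rayleigh_tent h.variance hσ hσ' j hε)
  set μ := σ2 / (12 * ((j : ℝ) + 1) ^ 2) with hμ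
  have hμ0 : 0 < μ := by positivity
  have hlim : Tendsto (fun L : ℕ => Real.exp (μ / 2 * L)) atTop atTop :=
    Real.tendsto_exp_atTop.comp
      (tendsto_natCast_atTop_atTop.const_mul_atTop (by positivity))
  filter_upwards [hev, hlim.eventually_ge_atTop (Real.exp ε / κ)] with L hL hL'
  rw [div_le_iff₀ hκ] at hL'
  have e1 : 1 / 24 * σ2 * L / ((j : ℝ) + 1) ^ 2 = μ / 2 * L := by
    rw [hμ]; field_simp; ring
  have e2 : Real.exp (μ * L) = Real.exp (μ / 2 * L) * Real.exp (μ / 2 * L) := by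
    rw [← Real.exp_add]; congr 1; ring
  rw [e1, Real.exp_neg, ← div_eq_inv_mul, le_div_iff₀ (Real.exp_pos ε)]
  refine le_trans ?_ hL
  rw [e2]
  nlinarith [mul_le_mul_of_nonneg_left hL' (Real.exp_nonneg (μ / 2 * L))]

theorem theorem1 (c₀ : ℝ) (hc₀ : 0 < c₀) (hc₀' : c₀ ≤ 1) :
    ∃ a b c : ℝ, b ≤ a ∧ 0 < b ∧ 0 < c ∧
      ∀ (j : ℕ) (σ2 : ℝ), 0 < σ2 → σ2 ≤ 1 / 2 →
      ∀ p : ℤ → ℝ, WalkClass c₀ σ2 p →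
        (∀ ε : ℝ, a * σ2 / ((j : ℝ) + 1) ≤ ε →
          ∀ᶠ L : ℕ in atTop,
            Real.exp (c * σ2 * (L : ℝ) / ((j : ℝ) + 1) ^ 2) ≤
              expectAbove p j L (fun γ => Real.exp (ε * (contacts γ : ℝ)))) ∧
        (∀ ε : ℝ, ε ≤ b * σ2 / ((j : ℝ) + 1) →
          ∀ L : ℕ,
            expectAbove p j L (fun γ => Real.exp (ε * (contacts γ : ℝ))) ≤
              2 * (partitionFn p L / partitionFnAbove p j L)) := by
  refine ⟨4, c₀ ^ 2 / 24320, 1 / 24, by nlinarith, by positivity, by norm_num, ?_⟩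
  intro j σ2 hσ hσ' p h
  have hp := h.isSymmStep
  have h0 : 0 < p 0 := by linarith [h.one_sub_le]
  refine ⟨fun ε hε => ?_, fun ε hε L => ?_⟩
  · filter_upwards [h.eventually_exp_le_pinned hc₀ hσ hσ' j hε, eventually_ge_atTop 1]
      with L hL hL1
    obtain ⟨n, rfl⟩ := Nat.exists_eq_add_of_le' hL1
    rw [hp.expectAbove_succ]
    have hZ := hp.partitionFnAbove_pos h0 j (n + 1)
    have hZ1 : partitionFnAbove p j (n + 1) ≤ 1 := by
      refine (hp.partitionFnAbove_le j (n + 1)).trans ?_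
      rw [hp.partitionFn_eq]
      exact hp.freeProfile_le_one _
    exact hL.trans (le_div_self ((Real.exp_nonneg _).trans hL) hZ hZ1)
  · have hZ := hp.partitionFnAbove_pos h0 j L
    rcases L with _ | n
    · rw [hp.expectAbove_zero h0, mul_div_assoc', le_div_iff₀ hZ]
      linarith [hp.partitionFnAbove_le j 0]
    · rw [hp.expectAbove_succ, hp.partitionFn_eq, ← mul_div_assoc]
      exact div_le_div_of_nonneg_right (h.pinned_le_two_mul hc₀ hc₀' hσ hσ' j hε n) hZ.le
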